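/- Let $\mathbb{H}=\mathbb{R}^3$ be the Heisenberg group with product $(x,y,z)(x',y',z')=(x+x',y+y',z+z'+\tfrac12(xy'-x'y))$ and the Koranyi metric $d(g,h)=N(g^{-1}h)$, $N(x,y,z)=((x^2+y^2)^2+\eta z^2)^{1/4}$, $\eta=2^{-1200}$; diameters, balls (always closed) and the Hausdorff measure $\mathcal{H}^1$ are taken with respect to $d$. Horizontal lines are the sets $\{g\cdot(ta,tb,0):t\in\mathbb{R}\}$ with $g\in\mathbb{H}$, $(a,b)\neq(0,0)$. Fix the constants $A=10$, $J=100$, $\kappa=3$, $\delta=2^{-10}$, $\varepsilon_0=10^{-10}$. **Curve and balls.** Let $\Gamma\subset\mathbb{H}$ with $\operatorname{diam}\Gamma=1$ be the image of a closed curve $\gamma:\mathbb{T}\to\mathbb{H}$ parametrized by arclength on a circle $\mathbb{T}$. Let $K\subset\Gamma$, and for $n\in\mathbb{Z}$ let $X_n\subset K$ be a $2^{-n}$-separated set such that every point of $K$ is at distance less than $2^{-n}$ from $X_n$, with $X_n\subset X_{n+1}$. Let $\mathcal{G}$ be the set of the balls $B(x,A2^{-n})$, $x\in X_n$, $n\in\mathbb{Z}$,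 of radius less than $1/100$. Write $\lambda B$ for the ball with the center of $B$ and $\lambda$ times its radius $r(B)$, and $$\beta_\Gamma(B)=\inf_{L}\ \sup_{x\in\Gamma\cap B}\frac{d(x,L)}{\operatorname{diam}(B)},$$ the infimum over all horizontal lines $L$. **Decompositions and cubes.** For a collection $\mathcal{B}$ of balls and an integer $J'$, a *$J'$-decomposition* of $\mathcal{B}$ is a partition $\mathcal{B}=\mathcal{B}_1\cup\dots\cup\mathcal{B}_D$ into finitely many disjoint subcollections such that for each $i$ distinct balls of $\mathcal{B}_i$ of equal radius $r$ are at distance $>\kappa r$, and $r(B_1)/r(B_2)\in 2^{J'\mathbb{Z}}$ for all $B_1,B_2\in\mathcal{B}_i$. For $B\in\mathcal{B}_i$ put $Q_0=B$, let $Q_{j+1}$ be the union of $Q_j$ and of all $B'\in\mathcal{B}_i$ with $B'\cap Q_j\ne\emptyset$ and $r(B')\le r(B)$, and call $\bigcup_j Q_j$ the *cube* of $B$ (with respect to $\mathcal{B}_i$). The family of the cubes of all $B\in\mathcal{B}_i$ is denoted $\Delta(\mathcal{B},i)$. **Arcs and filtrations.** Fix a $J$-decomposition $2\mathcal{G}=\{2B:B\in\mathcal{G}\}=\mathcal{B}_1\cup\dots\cup\mathcal{B}_D$.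 For $B\in\mathcal{G}$ with $2B\in\mathcal{B}_i$ let $Q(B)$ be the cube of $2B$ with respect to $\mathcal{B}_i$, and let $\Lambda(Q(B))$ be the set of the closed arcs of $\mathbb{T}$ that are closures of connected components of $\gamma^{-1}(Q(B))$ and whose image under $\gamma$ meets $B$. For each $i$ let $l(i)\in\{0,\dots,J-1\}$, $L_i=A2^{l(i)}$ and $m_i\in\mathbb{Z}$ be such that every $B$ with $2B\in\mathcal{B}_i$ has radius $L_i2^{-nJ}$ for some integer $n\ge m_i$, and let $\mathcal{F}^{0,i}_n$ be the union of the sets $\Lambda(Q(B))$ over the $B$ with $2B\in\mathcal{B}_i$ and $r(B)=L_i2^{-nJ}$. For an arc $\tau$, $\operatorname{diam}\tau$ is the diameter of $\gamma(\tau)$. For each $i$ let $(\mathcal{F}^i_n)_{n\ge m_i}$ be a filtration completing $(\mathcal{F}^{0,i}_n)_n$, that is, collections of nondegenerate closed arcs of $\mathbb{T}$ such that for all $n\ge m_i$: each $\zeta\in\mathcal{F}^i_{n+1}$ lies in a unique $\tau\in\mathcal{F}^i_n$; $\delta L_i2^{-nJ}\le\operatorname{diam}\tau<L_i2^{-nJ+4}$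 for $\tau\in\mathcal{F}^i_n$; two distinct arcs of $\mathcal{F}^i_n$ meet at most in common endpoints; the arcs of $\mathcal{F}^i_n$ cover $\mathbb{T}$; each $\tau^0\in\mathcal{F}^{0,i}_n$ lies in some $\tau\in\mathcal{F}^i_n$ such that $\tau\setminus\tau^0$ has at most two connected components, each with image of diameter $<\delta L_i2^{-nJ}$; and distinct arcs of $\mathcal{F}^{0,i}_n$ do not lie in the same arc of $\mathcal{F}^i_n$. For $2B\in\mathcal{B}_i$ with $r(B)=L_i2^{-nJ}$ let $\Lambda'(Q(B))$ be the set of the arcs of $\mathcal{F}^i_n$ that contain an arc of $\Lambda(Q(B))$. **Flat balls.** For an arc $\tau$ with initial point $a$ and final point $b$, let $\gamma(a)^{-1}\gamma(b)=(u,v,w)$, $L_\tau=\{\gamma(a)\cdot(tu,tv,0):t\in[0,1]\}$ and $\beta(\tau)=\sup_{t\in\tau}d(\gamma(t),L_\tau)/\operatorname{diam}\tau$. Let $$\mathcal{G}_2=\{B\in\mathcal{G}:\ \beta(\tau')<\varepsilon_0\,\beta_\Gamma(B)\ \text{ for all } \tau'\in\Lambda'(Q(B))\}.$$ **Claim.**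 Let $M\ge 0$ be an integer, let $\mathcal{B}^M=\{2B: B\in\mathcal{G}_2,\ \beta_\Gamma(B)\in[2^{-M-1},2^{-M}]\}$, let $J_M$ be the smallest integer larger than $M-\log_2(10\varepsilon_0)+10$, let $\mathcal{B}^M=\mathcal{B}^M_1\cup\dots\cup\mathcal{B}^M_{D_M}$ be a $J_M$-decomposition, and let $\Delta=\Delta(\mathcal{B}^M,i)$ for some $i\in\{1,\dots,D_M\}$. Then $$\sum_{Q\in\Delta}\operatorname{diam}(Q)\ \le\ \frac{10}{\varepsilon_0}\,2^M\,\mathcal{H}^1(\Gamma).$$ -/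

import Mathlib

open MeasureTheory Set

namespace HeisTSP

noncomputable section

/-! ## The Heisenberg group and its Koranyi metric -/

/-- The parameter `η` of the Koranyi norm. -/
def eta : ℝ := (2 : ℝ) ^ (-1200 : ℤ)

theorem eta_pos : 0 < eta := by
  unfold eta
  exact zpow_pos (by norm_num) _

theorem eta_le : eta ≤ 16 := by
  have h : eta ≤ 1 := by
    unfold eta
    exact zpow_le_one_of_nonpos₀ (by norm_num) (by norm_num)
  linarith

/-- The underlying set `ℝ³` of the Heisenberg group. -/
@[ext]
structure Heis where
  x : ℝ
  y : ℝ
  z : ℝ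

namespace Heis

instance : Mul Heis :=
  ⟨fun g h => ⟨g.x + h.x, g.y + h.y, g.z + h.z + 1 / 2 * (g.x * h.y - h.x * g.y)⟩⟩

instance : One Heis := ⟨⟨0, 0, 0⟩⟩

instance : Inv Heis := ⟨fun g => ⟨-g.x, -g.y, -g.z⟩⟩

@[simp] theorem mul_x (g h : Heis) : (g * h).x = g.x + h.x := rfl
@[simp] theorem mul_y (g h : Heis) : (g * h).y = g.y + h.y := rfl
@[simp] theorem mul_z (g h : Heis) :
    (g * h).z = g.z + h.z + 1 / 2 * (g.x * h.y - h.x * g.y) := rfl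
@[simp] theorem one_x : (1 : Heis).x = 0 := rfl
@[simp] theorem one_y : (1 : Heis).y = 0 := rfl
@[simp] theorem one_z : (1 : Heis).z = 0 := rfl
@[simp] theorem inv_x (g : Heis) : (g⁻¹).x = -g.x := rfl
@[simp] theorem inv_y (g : Heis) : (g⁻¹).y = -g.y := rfl
@[simp] theorem inv_z (g : Heis) : (g⁻¹).z = -g.z := rfl

instance : Group Heis :=
  Group.ofLeftAxioms
    (by intro a b c; ext <;> simp <;> ring)
    (by intro a; ext <;> simp)
    (by intro a; ext <;> simp)

/-- The Koranyi norm `((x² + y²)² + η z²)^{1/4}`. -/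
def N (g : Heis) : ℝ := ((g.x ^ 2 + g.y ^ 2) ^ 2 + eta * g.z ^ 2) ^ (1 / 4 : ℝ)

theorem base_nonneg (g : Heis) : 0 ≤ (g.x ^ 2 + g.y ^ 2) ^ 2 + eta * g.z ^ 2 := by
  have := eta_pos
  positivity

theorem N_nonneg (g : Heis) : 0 ≤ N g := Real.rpow_nonneg (base_nonneg g) _

theorem N_pow_four (g : Heis) : N g ^ 4 = (g.x ^ 2 + g.y ^ 2) ^ 2 + eta * g.z ^ 2 := by
  unfold N
  rw [← Real.rpow_natCast, ← Real.rpow_mul (base_nonneg g)]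
  norm_num

theorem N_inv (g : Heis) : N g⁻¹ = N g := by
  unfold N
  simp

theorem N_one : N 1 = 0 := by
  unfold N
  simp

theorem eq_one_of_N_eq_zero {g : Heis} (h : N g = 0) : g = 1 := by
  have h4 := N_pow_four g
  rw [h] at h4
  have he := eta_pos
  have h1 : 0 ≤ (g.x ^ 2 + g.y ^ 2) ^ 2 := by positivity
  have h2 : 0 ≤ eta * g.z ^ 2 := by positivity
  have h3 : (g.x ^ 2 + g.y ^ 2) ^ 2 = 0 := by norm_num at h4; linarith
  have h5 : eta * g.z ^ 2 = 0 := by norm_num at h4; linarith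
  have h6 : g.x ^ 2 + g.y ^ 2 = 0 := by simpa using h3
  have hx : g.x = 0 := by nlinarith [sq_nonneg g.x, sq_nonneg g.y]
  have hy : g.y = 0 := by nlinarith [sq_nonneg g.x, sq_nonneg g.y]
  have hz : g.z = 0 := by
    rcases mul_eq_zero.1 h5 with h | h
    · linarith
    · simpa using h
  ext <;> simp [hx, hy, hz]

theorem N_mul_le (g h : Heis) : N (g * h) ≤ N g + N h := by
  have hs : Real.sqrt eta ^ 2 = eta := Real.sq_sqrt eta_pos.le
  have key : ∀ (k : Heis), ‖(⟨k.x ^ 2 + k.y ^ 2, Real.sqrt eta * k.z⟩ : ℂ)‖ = N k ^ 2 := by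
    intro k
    have e1 : ‖(⟨k.x ^ 2 + k.y ^ 2, Real.sqrt eta * k.z⟩ : ℂ)‖ ^ 2 = (N k ^ 2) ^ 2 := by
      rw [Complex.sq_norm, Complex.normSq_mk, ← pow_mul, N_pow_four]
      linear_combination k.z ^ 2 * hs
    exact (sq_eq_sq₀ (norm_nonneg _) (by positivity)).1 e1
  have hN : ∀ k : Heis, k.x ^ 2 + k.y ^ 2 ≤ N k ^ 2 := by
    intro k
    rw [← key]
    exact (le_abs_self _).trans
      (Complex.abs_re_le_norm (⟨k.x ^ 2 + k.y ^ 2, Real.sqrt eta * k.z⟩ : ℂ))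
  set V : ℂ := ⟨2 * (g.x * h.x + g.y * h.y),
    Real.sqrt eta * (1 / 2 * (g.x * h.y - h.x * g.y))⟩ with hV
  have hVle : ‖V‖ ≤ 2 * (N g * N h) := by
    have hng := N_nonneg g
    have hnh := N_nonneg h
    refine abs_le_of_sq_le_sq' ?_ (by positivity) |>.2
    rw [Complex.sq_norm, hV, Complex.normSq_mk]
    have h1 : (g.x ^ 2 + g.y ^ 2) * (h.x ^ 2 + h.y ^ 2) ≤ N g ^ 2 * N h ^ 2 :=
      mul_le_mul (hN g) (hN h) (by positivity) (by positivity)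
    have h2 : eta * (1 / 2 * (g.x * h.y - h.x * g.y)) ^ 2
        ≤ 16 * (1 / 2 * (g.x * h.y - h.x * g.y)) ^ 2 :=
      mul_le_mul_of_nonneg_right eta_le (by positivity)
    have h3 : Real.sqrt eta * (1 / 2 * (g.x * h.y - h.x * g.y)) *
        (Real.sqrt eta * (1 / 2 * (g.x * h.y - h.x * g.y)))
        = eta * (1 / 2 * (g.x * h.y - h.x * g.y)) ^ 2 := by
      linear_combination (1 / 2 * (g.x * h.y - h.x * g.y)) ^ 2 * hs
    rw [h3]
    nlinarith
  have hsum : (⟨(g * h).x ^ 2 + (g * h).y ^ 2, Real.sqrt eta * (g * h).z⟩ : ℂ)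
      = ⟨g.x ^ 2 + g.y ^ 2, Real.sqrt eta * g.z⟩ + ⟨h.x ^ 2 + h.y ^ 2, Real.sqrt eta * h.z⟩
        + V := by
    apply Complex.ext
    · simp [hV]; ring
    · simp [hV]; ring
  have h1 : N (g * h) ^ 2 ≤ (N g + N h) ^ 2 := by
    rw [← key (g * h), hsum]
    refine (norm_add₃_le).trans ?_
    rw [key g, key h]
    nlinarith
  exact abs_le_of_sq_le_sq' h1 (add_nonneg (N_nonneg g) (N_nonneg h)) |>.2

/-- The Koranyi metric `d(g, h) = N(g⁻¹ h)`. -/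
instance : MetricSpace Heis where
  dist g h := N (g⁻¹ * h)
  dist_self g := by
    rw [inv_mul_cancel, N_one]
  dist_comm g h := by
    rw [← N_inv (g⁻¹ * h), mul_inv_rev, inv_inv]
  dist_triangle f g h := by
    have e : f⁻¹ * h = (f⁻¹ * g) * (g⁻¹ * h) := by group
    rw [e]
    exact N_mul_le _ _
  eq_of_dist_eq_zero := by
    intro g h hgh
    exact inv_mul_eq_one.1 (eq_one_of_N_eq_zero hgh)

theorem dist_def (g h : Heis) : dist g h = N (g⁻¹ * h) := rfl

instance : MeasurableSpace Heis := borel Heis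

instance : BorelSpace Heis := ⟨rfl⟩

/-- The horizontal element below `g`. -/
def proj (g : Heis) : Heis := ⟨g.x, g.y, 0⟩

/-- `δ_t` on horizontal elements, for every real `t`, is `(x, y, 0) ↦ (t x, t y, 0)`; in general
`δ_t (x, y, z) = (t x, t y, t² z)`. -/
def dil (t : ℝ) (g : Heis) : Heis := ⟨t * g.x, t * g.y, t ^ 2 * g.z⟩

end Heis

/-- Horizontal lines `{g · δ_t(h) : t ∈ ℝ}`, with `h ≠ 0` horizontal. -/
def IsHorizontalLine (L : Set Heis) : Prop :=
  ∃ g h : Heis, h.z = 0 ∧ h ≠ 1 ∧ L = range fun t : ℝ => g * Heis.dil t h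

/-- The horizontal segment which starts at `a` in the horizontal direction of `a⁻¹ b`. -/
def horSegment (a b : Heis) : Set Heis :=
  (fun t : ℝ => a * Heis.dil t (Heis.proj (a⁻¹ * b))) '' Icc 0 1

/-! ## Constants -/

/-- The implied constant `A` of the multiresolution. -/
def A : ℝ := 10

/-- The constant `ε₀`. -/
def eps0 : ℝ := (10 : ℝ) ^ (-10 : ℤ)

/-- The constant `J` of the first decomposition and of the filtrations. -/
def J0 : ℤ := 100

/-- The separation constant `κ`. -/
def kappa : ℝ := 3

/-- The constant `δ` of the filtrations. -/
def delta : ℝ := (2 : ℝ) ^ (-10 : ℤ)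

/-- `J_M`, the smallest integer larger than `M - log₂ (10 ε₀) + 10`. -/
def JM (M : ℕ) : ℤ := ⌊(M : ℝ) - Real.logb 2 (10 * eps0) + 10⌋ + 1

/-! ## Balls, multiresolutions, beta numbers -/

/-- A ball, recorded by its center and its radius. -/
@[ext]
structure HBall where
  center : Heis
  radius : ℝ

/-- The closed ball as a set. -/
def HBall.toSet (B : HBall) : Set Heis := Metric.closedBall B.center B.radius

/-- The double `2B`. -/
def HBall.double (B : HBall) : HBall := ⟨B.center, 2 * B.radius⟩

/-- `X n`, `n ∈ ℤ`, is an increasing family of `2^{-n}` separated nets for `K`. -/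
def IsNetFamily (K : Set Heis) (X : ℤ → Set Heis) : Prop :=
  ∀ n : ℤ, X n ⊆ K ∧ (∀ x ∈ X n, ∀ y ∈ X n, x ≠ y → (2 : ℝ) ^ (-n) ≤ dist x y) ∧
    (∀ z ∈ K, ∃ x ∈ X n, dist x z < (2 : ℝ) ^ (-n)) ∧ X n ⊆ X (n + 1)

/-- The balls of the multiresolution whose radius is less than `1/100`. -/
def ballsG (X : ℤ → Set Heis) : Set HBall :=
  {B | (∃ n : ℤ, B.center ∈ X n ∧ B.radius = A * (2 : ℝ) ^ (-n)) ∧ B.radius < 1 / 100}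

/-- `β_Γ(B) = inf_L sup_{x ∈ Γ ∩ B} d(x, L) / diam B`. -/
def betaBall (Γ : Set Heis) (B : HBall) : ℝ :=
  ⨅ L : {L : Set Heis // IsHorizontalLine L},
    ⨆ x : ↥(Γ ∩ B.toSet), Metric.infDist (x : Heis) L.1 / Metric.diam B.toSet

/-- The distance between two sets. -/
def setDist (S T : Set Heis) : ℝ := sInf (image2 dist S T)

/-- `Bi` is a decomposition of the collection `Bs` of balls into pairwise disjoint subcollections;
in each subcollection, distinct balls of the same radius `r` are at distance more than `κ r`, and
the quotient of two radii is an integer power of `2^J`. -/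
def IsDecomposition (J : ℤ) (κ : ℝ) (Bs : Set HBall) {D : ℕ} (Bi : Fin D → Set HBall) : Prop :=
  (⋃ i, Bi i) = Bs ∧ (∀ i j, i ≠ j → Bi i ∩ Bi j = ∅) ∧
    ∀ i, ∀ B₁ ∈ Bi i, ∀ B₂ ∈ Bi i,
      (B₁ ≠ B₂ → B₁.radius = B₂.radius → κ * B₁.radius < setDist B₁.toSet B₂.toSet) ∧
      ∃ k : ℤ, B₁.radius / B₂.radius = (2 : ℝ) ^ (J * k)

/-! ## Dyadic-like cubes -/

/-- The increasing sets `Q_0 = B`, and `Q_{i+1}` the union of `Q_i` and of all balls of the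
collection which meet `Q_i` and have radius at most that of `B`. -/
def cubeLayer (Bs : Set HBall) (B : HBall) : ℕ → Set Heis
  | 0 => B.toSet
  | i + 1 => cubeLayer Bs B i ∪
      ⋃ B' ∈ {B' ∈ Bs | (B'.toSet ∩ cubeLayer Bs B i).Nonempty ∧ B'.radius ≤ B.radius}, B'.toSet

/-- The cube built from the ball `B` of the collection `Bs`. -/
def cube (Bs : Set HBall) (B : HBall) : Set Heis := ⋃ i, cubeLayer Bs B i

/-- The family of the cubes built from the balls of the collection. -/
def cubes (Bs : Set HBall) : Set (Set Heis) := cube Bs '' Bs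

/-! ## Arcs of a closed curve -/

/-- A nondegenerate closed arc of the circle of circumference `p`, given by its initial point and
its length. -/
@[ext]
structure Arc (p : ℝ) where
  src : AddCircle p
  len : ℝ
  len_pos : 0 < len
  len_le : len ≤ p

namespace Arc

variable {p : ℝ}

/-- The final point of an arc. -/
def tgt (τ : Arc p) : AddCircle p := τ.src + ((τ.len : ℝ) : AddCircle p)

/-- The arc as a subset of the circle. -/
def carrier (τ : Arc p) : Set (AddCircle p) :=
  (fun s : ℝ => τ.src + (s : AddCircle p)) '' Icc 0 τ.len

/-- The diameter of the image of an arc. -/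
def diam (γ : AddCircle p → Heis) (τ : Arc p) : ℝ := Metric.diam (γ '' τ.carrier)

/-- `β(τ) = sup_t d(γ(t), L_τ) / diam τ`, where `L_τ` is the horizontal segment which starts at
the initial point of `τ` and goes towards its final point. -/
def beta (γ : AddCircle p → Heis) (τ : Arc p) : ℝ :=
  ⨆ t : ↥τ.carrier,
    Metric.infDist (γ t) (horSegment (γ τ.src) (γ τ.tgt)) / τ.diam γ

end Arc

/-- The arcs through `Q` which meet `B`: closures of the connected components of `γ⁻¹(Q)` whose
image meets `B`. -/
def arcsThrough {p : ℝ} (γ : AddCircle p → Heis) (Q B : Set Heis) : Set (Arc p) :=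
  {τ | (∃ t ∈ γ ⁻¹' Q, τ.carrier = closure (connectedComponentIn (γ ⁻¹' Q) t)) ∧
    (γ '' τ.carrier ∩ B).Nonempty}

/-- The arcs of scale `n` (that is, for balls `B` of radius `L 2^{-nJ}`) through the cubes built
from the doubles `2B` in the collection `Bs`. -/
def prefiltration {p : ℝ} (γ : AddCircle p → Heis) (J : ℤ) (L : ℝ) (Bs : Set HBall) (n : ℤ) :
    Set (Arc p) :=
  {τ | ∃ B : HBall, B.double ∈ Bs ∧ B.radius = L * (2 : ℝ) ^ (-(n * J)) ∧
    τ ∈ arcsThrough γ (cube Bs B.double) B.toSet}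

/-- `F n`, `n ≥ m`, is a filtration of the circle which completes the families `F0 n`. -/
structure IsFiltration {p : ℝ} (γ : AddCircle p → Heis) (J : ℤ) (δ L : ℝ) (m : ℤ)
    (F0 F : ℤ → Set (Arc p)) : Prop where
  exists_unique_parent : ∀ n ≥ m, ∀ ζ ∈ F (n + 1), ∃! τ, τ ∈ F n ∧ ζ.carrier ⊆ τ.carrier
  diam_bounds : ∀ n ≥ m, ∀ τ ∈ F n,
    δ * L * (2 : ℝ) ^ (-(n * J)) ≤ τ.diam γ ∧ τ.diam γ < L * (2 : ℝ) ^ (-(n * J) + 4)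
  inter_subset_endpoints : ∀ n ≥ m, ∀ τ₁ ∈ F n, ∀ τ₂ ∈ F n, τ₁ = τ₂ ∨
    τ₁.carrier ∩ τ₂.carrier ⊆ {τ₁.src, τ₁.tgt} ∩ {τ₂.src, τ₂.tgt}
  covers : ∀ n ≥ m, (⋃ τ ∈ F n, τ.carrier) = univ
  extends_arcs : ∀ n ≥ m, ∀ τ₀ ∈ F0 n, ∃ τ ∈ F n, τ₀.carrier ⊆ τ.carrier ∧
    {C | ∃ t ∈ τ.carrier \ τ₀.carrier,
      C = connectedComponentIn (τ.carrier \ τ₀.carrier) t}.encard ≤ 2 ∧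
    ∀ t ∈ τ.carrier \ τ₀.carrier,
      Metric.diam (γ '' connectedComponentIn (τ.carrier \ τ₀.carrier) t)
        < δ * L * (2 : ℝ) ^ (-(n * J))
  extensions_ne : ∀ n ≥ m, ∀ τ₀ ∈ F0 n, ∀ τ₁ ∈ F0 n, τ₀ ≠ τ₁ → ∀ τ₀' ∈ F n, ∀ τ₁' ∈ F n,
    τ₀.carrier ⊆ τ₀'.carrier → τ₁.carrier ⊆ τ₁'.carrier → τ₀' ≠ τ₁'

/-- The arcs of the filtration, at the scale `n` of `B` (`r(B) = L 2^{-nJ}`), which extend an arc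
through the cube of `2B` that meets `B`. -/
def extendedArcs {p : ℝ} (γ : AddCircle p → Heis) (J : ℤ) (L : ℝ) (Bs : Set HBall)
    (F : ℤ → Set (Arc p)) (B : HBall) : Set (Arc p) :=
  {τ' | ∃ n : ℤ, B.radius = L * (2 : ℝ) ^ (-(n * J)) ∧ τ' ∈ F n ∧
    ∃ τ ∈ arcsThrough γ (cube Bs B.double) B.toSet, τ.carrier ⊆ τ'.carrier}

/-- The length scale `L = A 2^l`. -/
def scaleL (l : ℕ) : ℝ := A * (2 : ℝ) ^ l

/-- The flat balls `G₂`: those `B` in `G` such that `β(τ') < ε₀ β_Γ(B)` for all extended arcs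
`τ'` of the cube of `2B`. -/
def ballsG2 {p : ℝ} (γ : AddCircle p → Heis) (Γ : Set Heis) (X : ℤ → Set Heis) {D : ℕ}
    (Bi : Fin D → Set HBall) (l : Fin D → ℕ) (F : Fin D → ℤ → Set (Arc p)) : Set HBall :=
  {B ∈ ballsG X | ∀ i, B.double ∈ Bi i →
    ∀ τ' ∈ extendedArcs γ J0 (scaleL (l i)) (Bi i) (F i) B, τ'.beta γ < eps0 * betaBall Γ B}

/-- The doubles of the balls `B` of a collection `G` with `β_Γ(B) ∈ [2^{-M-1}, 2^{-M}]`. -/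
def ballsM (Γ : Set Heis) (G : Set HBall) (M : ℕ) : Set HBall :=
  HBall.double '' {B ∈ G | betaBall Γ B ∈ Icc ((2 : ℝ) ^ (-(M : ℤ) - 1)) ((2 : ℝ) ^ (-(M : ℤ)))}

end

end HeisTSP

open HeisTSP

namespace HeisTSP

/-! ## Separated families of balls -/

/-! Put `s = 2^{-M}`. The theorem follows from a local gain of length, which is summed over the
nested family of cubes. Local gain (`cube_length_growth`): let `Q` be the cube of `2B` and `r =
r(B)`. Since `2^{-J_M}` is at most `s ε₀ / 100`, the smaller balls that build `Q` enlarge `2B` very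
little, and `diam Q` exceeds `4r` by at most a tiny multiple of `ε₀ s r`. The flatness of the
extended arc through the center of `B` gives a piece `E` of `Γ ∩ 2B` that runs along a horizontal
line `L` and projects onto an interval of length `4r - 128 ε₀ s r`
(`exists_crossing_of_mem_ballsG2`). But `β_Γ(B) ≥ s/2` forces some `z ∈ Γ ∩ B` to have distance at
least `s r / 2` from `L`, and by connectedness `Γ` has a further piece near `z` whose image under
the distance to `z` contains `[0, s r / 8]`. This extra length dominates every error, because `ε₀`
is tiny. Cubes of smaller balls are too small to meet both pieces, so removing them costs at most
the sum of their diameters. Hence `(1 + ε₀ s / 10) diam Q` is at most the length of `Γ ∩ Q` outside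
any finite set of smaller cubes plus the diameters of those cubes. Summation
(`exists_disjoint_packing`): cubes are nested or disjoint (`cube_nested`). Adding them by increasing
radius, each cube contributes its surplus `(ε₀ s / 10) diam Q`, while its remaining length pays for
the smaller cubes it absorbs. The surpluses therefore add up to at most `ℋ¹(Γ)`. -/

/-- Distinct balls of equal radius `r` are more than `3 r` apart, and unequal radii differ at
least by the factor `q`. -/
structure ScaleSeparated (q : ℝ) (Bs : Set HBall) : Prop where
  pos : ∀ B ∈ Bs, 0 < B.radius
  sep : ∀ B₁ ∈ Bs, ∀ B₂ ∈ Bs, B₁ ≠ B₂ → B₁.radius = B₂.radius →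
    ∀ z ∈ B₁.toSet, ∀ w ∈ B₂.toSet, 3 * B₁.radius < dist z w
  ratio : ∀ B₁ ∈ Bs, ∀ B₂ ∈ Bs, B₁.radius < B₂.radius → B₁.radius ≤ q * B₂.radius
  q_pos : 0 < q
  q_le : q ≤ 1 / 16

theorem setDist_le {S T : Set Heis} {z w : Heis} (hz : z ∈ S) (hw : w ∈ T) :
    setDist S T ≤ dist z w := by
  refine csInf_le ⟨0, ?_⟩ (mem_image2_of_mem hz hw)
  rintro _ ⟨a, _, b, _, rfl⟩
  exact dist_nonneg

/-- Unequal radii have quotient `2^{Jk}` with `k ≠ 0`, so the smaller is at most `2^{-J}` times the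
larger; `4 ≤ J` is what makes this factor at most `1/16`. -/
theorem IsDecomposition.scaleSeparated {J : ℤ} {Bs : Set HBall} {D : ℕ} {Bi : Fin D → Set HBall}
    (h : IsDecomposition J kappa Bs Bi) (hJ : 4 ≤ J) (hpos : ∀ B ∈ Bs, 0 < B.radius) (i : Fin D) :
    ScaleSeparated ((2 : ℝ) ^ (-J)) (Bi i) := by
  have hsub : ∀ B ∈ Bi i, 0 < B.radius := fun B hB =>
    hpos B (h.1 ▸ mem_iUnion_of_mem i hB)
  refine ⟨hsub, ?_, ?_, by positivity, ?_⟩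
  · intro B₁ h₁ B₂ h₂ hne hr z hz w hw
    exact ((h.2.2 i B₁ h₁ B₂ h₂).1 hne hr).trans_le (setDist_le hz hw)
  · intro B₁ h₁ B₂ h₂ hlt
    obtain ⟨k, hk⟩ := (h.2.2 i B₁ h₁ B₂ h₂).2
    have p₂ := hsub B₂ h₂
    have h1 : B₁.radius / B₂.radius < 1 := (div_lt_one p₂).2 hlt
    rw [hk] at h1
    have hk0 : J * k < 0 := by
      by_contra hcon
      exact absurd (one_le_zpow₀ (by norm_num : (1 : ℝ) ≤ 2) (not_lt.1 hcon)) (not_le.2 h1)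
    have hk1 : J * k ≤ -J := by
      have : k ≤ -1 := by
        by_contra hcon
        have : 0 ≤ J * k := mul_nonneg (by omega) (by omega)
        omega
      nlinarith
    rw [← div_le_iff₀ p₂, hk]
    exact zpow_le_zpow_right₀ (by norm_num) hk1
  · calc (2 : ℝ) ^ (-J) ≤ 2 ^ (-4 : ℤ) := zpow_le_zpow_right₀ (by norm_num) (by omega)
      _ = 1 / 16 := by norm_num

/-! ### Chains of intersecting balls -/

/-- `z` and `w` are joined by a chain of `n` successively intersecting balls of radius at
most `ρ`. -/
def BallChain (Bs : Set HBall) (ρ : ℝ) : ℕ → Heis → Heis → Prop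
  | 0, z, w => z = w
  | n + 1, z, w => ∃ y, BallChain Bs ρ n z y ∧ ∃ b ∈ Bs, b.radius ≤ ρ ∧ y ∈ b.toSet ∧ w ∈ b.toSet

namespace BallChain

variable {Bs : Set HBall} {ρ σ q : ℝ}

theorem mono (h : ρ ≤ σ) : ∀ {n : ℕ} {z w : Heis}, BallChain Bs ρ n z w → BallChain Bs σ n z w
  | 0, _, _, hc => hc
  | _ + 1, _, _, ⟨y, hy, b, hb, hr, h1, h2⟩ => ⟨y, mono h hy, b, hb, hr.trans h, h1, h2⟩

theorem trans {m : ℕ} {z y : Heis} (h : BallChain Bs ρ m z y) :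
    ∀ {n : ℕ} {w : Heis}, BallChain Bs ρ n y w → BallChain Bs ρ (m + n) z w
  | 0, _, hc => by cases hc; exact h
  | _ + 1, _, ⟨y, hy, hb⟩ => ⟨y, trans h hy, hb⟩

theorem single {b : HBall} (hb : b ∈ Bs) (hr : b.radius ≤ ρ) {z w : Heis} (hz : z ∈ b.toSet)
    (hw : w ∈ b.toSet) : BallChain Bs ρ 1 z w :=
  ⟨z, rfl, b, hb, hr, hz, hw⟩

theorem symm : ∀ {n : ℕ} {z w : Heis}, BallChain Bs ρ n z w → BallChain Bs ρ n w z
  | 0, _, _, hc => Eq.symm hc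
  | n + 1, _, _, ⟨_, hy, _, hb, hr, h1, h2⟩ => by
    have := (single hb hr h2 h1).trans (symm hy)
    rwa [add_comm] at this

/-- A nonempty chain splits at a ball of largest radius. -/
theorem exists_largest : ∀ {n : ℕ} {z w : Heis}, BallChain Bs ρ (n + 1) z w →
    ∃ b ∈ Bs, b.radius ≤ ρ ∧ ∃ i j : ℕ, i + j = n ∧ ∃ y ∈ b.toSet, ∃ y' ∈ b.toSet,
      BallChain Bs b.radius i z y ∧ BallChain Bs b.radius j y' w
  | 0, z, w, ⟨y, hy, b, hb, hr, h1, h2⟩ => by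
    cases hy
    exact ⟨b, hb, hr, 0, 0, rfl, z, h1, w, h2, rfl, rfl⟩
  | n + 1, z, w, ⟨y, hy, b, hb, hr, h1, h2⟩ => by
    obtain ⟨b', hb', hr', i, j, hij, u, hu, u', hu', hc, hc'⟩ := exists_largest hy
    rcases le_total b.radius b'.radius with hle | hle
    · exact ⟨b', hb', hr', i, j + 1, by omega, u, hu, u', hu', hc, y, hc', b, hb, hle, h1, h2⟩
    · refine ⟨b, hb, hr, n + 1, 0, rfl, y, h1, w, h2, ?_, rfl⟩
      have := ((hc.trans (single hb' le_rfl hu hu')).trans hc').mono hle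
      rwa [show i + 1 + j = n + 1 by omega] at this

/-- The chain is peeled from its end near `b`, keeping a tail of balls of radius at most `q r(b)`
that leads to `b`. A smaller ball joins the tail. A ball of the same radius as `b` must be `b`,
since by `hA` the tail is shorter than the separation `3 r(b)`; the tail then restarts empty from
`b`. When the chain is used up, the tail alone joins `z` to `b`. -/
theorem exists_close (hS : ScaleSeparated q Bs) {b : HBall} (hb : b ∈ Bs) {n : ℕ}
    (hA : ∀ m < n, ∀ ρ z w, 0 ≤ ρ → BallChain Bs ρ m z w → dist z w ≤ 2 * ρ * (1 + 3 * q)) :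
    ∀ (i k : ℕ) {z y y₁ : Heis}, i + k < n → BallChain Bs b.radius i z y →
      BallChain Bs (q * b.radius) k y y₁ → y₁ ∈ b.toSet →
      ∃ y₂ ∈ b.toSet, dist z y₂ ≤ 2 * (q * b.radius) * (1 + 3 * q)
  | 0, k, z, y, y₁, hik, hc, hc', hy₁ => by
    cases hc
    have h0 := hS.pos b hb
    have h1 := hS.q_pos
    exact ⟨y₁, hy₁, hA k (by omega) _ _ _ (by positivity) hc'⟩
  | i + 1, k, z, y, y₁, hik, ⟨y₀, hy₀, b', hb', hr', h1, h2⟩, hc', hy₁ => by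
    have p0 := hS.pos b hb
    have q0 := hS.q_pos
    have q1 := hS.q_le
    rcases hr'.eq_or_lt with heq | hlt
    · have hd := hA k (by omega) _ _ _ (by positivity) hc'
      have hbb : b' = b := by
        by_contra hne
        have := hS.sep b' hb' b hb hne heq y h2 y₁ hy₁
        rw [heq] at this
        have hq : 2 * (q * b.radius) * (1 + 3 * q) ≤ 3 * b.radius := by
          have : q * (1 + 3 * q) ≤ 1 := by nlinarith
          nlinarith
        linarith
      subst hbb
      exact exists_close hS hb hA i 0 (by omega) hy₀ (rfl : BallChain Bs _ 0 y₀ y₀) h1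
    · refine exists_close hS hb hA i (1 + k) (by omega) hy₀
        ((single hb' (hS.ratio b' hb' b hb hlt) h1 h2).trans hc') hy₁

theorem _root_.HeisTSP.HBall.dist_le_of_mem {b : HBall} {z w : Heis} (hz : z ∈ b.toSet)
    (hw : w ∈ b.toSet) : dist z w ≤ 2 * b.radius := by
  have h1 : dist z b.center ≤ b.radius := hz
  have h2 : dist w b.center ≤ b.radius := hw
  have := dist_triangle_right z w b.center
  linarith

/-- Strong induction on the number of balls: split the chain at a largest ball `b`. Both remaining
chains are shorter, so by `exists_close` each end is close to `b`, and the rest is the diameter of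
`b`. -/
theorem dist_le (hS : ScaleSeparated q Bs) : ∀ (n : ℕ) (ρ : ℝ) (z w : Heis), 0 ≤ ρ →
    BallChain Bs ρ n z w → dist z w ≤ 2 * ρ * (1 + 3 * q) := by
  intro n
  induction n using Nat.strong_induction_on with
  | _ n ih =>
    intro ρ z w hρ hc
    have q0 := hS.q_pos
    have q1 := hS.q_le
    rcases n with _ | n
    · cases hc
      rw [dist_self]
      positivity
    · obtain ⟨b, hb, hr, i, j, hij, y, hy, y', hy', h1, h2⟩ := exists_largest hc
      have p0 := hS.pos b hb
      obtain ⟨u, hu, hdu⟩ := exists_close hS hb ih i 0 (by omega) h1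
        (rfl : BallChain Bs _ 0 y y) hy
      obtain ⟨v, hv, hdv⟩ := exists_close hS hb ih j 0 (by omega) h2.symm
        (rfl : BallChain Bs _ 0 y' y') hy'
      have huv := HBall.dist_le_of_mem hu hv
      have t := dist_triangle4 z u v w
      rw [dist_comm v w] at t
      -- The constant `3` reproduces itself: `2 (1 + 3q) ≤ 3` because `q ≤ 1/16`.
      have e : 2 * (q * b.radius) * (1 + 3 * q) ≤ 3 * q * b.radius := by
        have : q * b.radius * (2 * (1 + 3 * q)) ≤ q * b.radius * 3 :=
          mul_le_mul_of_nonneg_left (by linarith) (by positivity)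
        linarith
      calc dist z w ≤ 2 * b.radius * (1 + 3 * q) := by linarith
        _ ≤ 2 * ρ * (1 + 3 * q) := by gcongr

end BallChain

/-! ## Cubes -/

theorem HBall.center_mem {B : HBall} (h : 0 ≤ B.radius) : B.center ∈ B.toSet :=
  Metric.mem_closedBall_self h

theorem subset_cube (Bs : Set HBall) (B : HBall) : B.toSet ⊆ cube Bs B :=
  subset_iUnion (cubeLayer Bs B) 0

/-- Reformulating cubes through chains lets memberships be concatenated and reversed, which the
layers do not allow directly. -/
theorem mem_cube_iff {Bs : Set HBall} {B : HBall} (hB : B ∈ Bs) (h0 : 0 ≤ B.radius) {z : Heis} :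
    z ∈ cube Bs B ↔ ∃ n, BallChain Bs B.radius n B.center z := by
  constructor
  · intro hz
    obtain ⟨n, hn⟩ := mem_iUnion.1 hz
    clear hz
    induction n generalizing z with
    | zero => exact ⟨1, BallChain.single hB le_rfl (HBall.center_mem h0) hn⟩
    | succ n ih =>
      rcases hn with hn | hn
      · exact ih hn
      · simp only [mem_iUnion, mem_ofPred_eq] at hn
        obtain ⟨B', ⟨hB', ⟨y, hy, hyn⟩, hr⟩, hz⟩ := hn
        obtain ⟨k, hk⟩ := ih hyn
        exact ⟨k + 1, y, hk, B', hB', hr, hy, hz⟩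
  · rintro ⟨n, hn⟩
    induction n generalizing z with
    | zero =>
      cases hn
      exact subset_cube Bs B (HBall.center_mem h0)
    | succ n ih =>
      obtain ⟨y, hy, b, hb, hr, h1, h2⟩ := hn
      obtain ⟨k, hk⟩ := mem_iUnion.1 (ih hy)
      refine mem_iUnion.2 ⟨k + 1, Or.inr ?_⟩
      simp only [mem_iUnion, mem_ofPred_eq]
      exact ⟨b, ⟨hb, ⟨y, h1, hk⟩, hr⟩, h2⟩

namespace ScaleSeparated

variable {q : ℝ} {Bs : Set HBall} {B B' : HBall}

theorem dist_le_of_mem_cube (hS : ScaleSeparated q Bs) (hB : B ∈ Bs) {z w : Heis}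
    (hz : z ∈ cube Bs B) (hw : w ∈ cube Bs B) : dist z w ≤ 2 * B.radius * (1 + 3 * q) := by
  have h0 := (hS.pos B hB).le
  obtain ⟨m, hm⟩ := (mem_cube_iff hB h0).1 hz
  obtain ⟨n, hn⟩ := (mem_cube_iff hB h0).1 hw
  exact BallChain.dist_le hS _ _ _ _ h0 (hm.symm.trans hn)

theorem ediam_cube_le (hS : ScaleSeparated q Bs) (hB : B ∈ Bs) :
    Metric.ediam (cube Bs B) ≤ ENNReal.ofReal (2 * B.radius * (1 + 3 * q)) := by
  refine Metric.ediam_le fun z hz w hw => ?_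
  rw [edist_dist]
  exact ENNReal.ofReal_le_ofReal (hS.dist_le_of_mem_cube hB hz hw)

/-- A common point joins the two centers by a chain of balls of radius at most `r(B)`. Equal radii
would put the centers within `2r(1 + 3q) < 3r`, against separation; otherwise this chain followed by
a chain inside the cube of `B'` stays in the cube of `B`. -/
theorem cube_nested (hS : ScaleSeparated q Bs) (hB : B ∈ Bs) (hB' : B' ∈ Bs) (hne : B' ≠ B)
    (hr : B'.radius ≤ B.radius) (hi : (cube Bs B' ∩ cube Bs B).Nonempty) :
    B'.radius < B.radius ∧ cube Bs B' ⊆ cube Bs B := by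
  have h0 := (hS.pos B hB).le
  have h0' := (hS.pos B' hB').le
  obtain ⟨z, hz', hz⟩ := hi
  obtain ⟨m, hm⟩ := (mem_cube_iff hB h0).1 hz
  obtain ⟨n, hn⟩ := (mem_cube_iff hB' h0').1 hz'
  have hc := hm.trans (hn.mono hr).symm
  constructor
  · refine hr.lt_of_ne fun heq => ?_
    have h1 := hS.sep B hB B' hB' hne.symm heq.symm _ (HBall.center_mem h0) _ (HBall.center_mem h0')
    have h2 := BallChain.dist_le hS _ _ _ _ h0 hc
    have := hS.q_le
    have := hS.pos B hB
    nlinarith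
  · intro w hw
    obtain ⟨k, hk⟩ := (mem_cube_iff hB' h0').1 hw
    exact (mem_cube_iff hB h0).2 ⟨_, hc.trans (hk.mono hr)⟩

end ScaleSeparated

theorem measurableSet_cube {Bs : Set HBall} (hc : Bs.Countable) (B : HBall) :
    MeasurableSet (cube Bs B) := by
  refine MeasurableSet.iUnion fun n => ?_
  induction n with
  | zero => exact Metric.isClosed_closedBall.measurableSet
  | succ n ih =>
    refine ih.union (MeasurableSet.biUnion (hc.mono fun _ h => h.1) fun B' _ => ?_)
    exact Metric.isClosed_closedBall.measurableSet

/-! ## Packing of cubes -/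

/-- `T` plays the role of the maximal cubes of `S`. The extra term `∑ diam` over `T` in the
induction claim is the reserve that pays when a larger cube swallows some members of `T`. -/
theorem exists_disjoint_packing {q : ℝ} {Bs : Set HBall} (hS : ScaleSeparated q Bs)
    (hcount : Bs.Countable) {μ : Measure Heis} {c : ENNReal}
    (hkey : ∀ B ∈ Bs, ∀ T : Finset HBall, (∀ B' ∈ T, B' ∈ Bs ∧ B'.radius < B.radius) →
      (1 + c) * Metric.ediam (cube Bs B) ≤
        μ (cube Bs B \ ⋃ B' ∈ T, cube Bs B') + ∑ B' ∈ T, Metric.ediam (cube Bs B'))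
    (S : Finset HBall) (hSB : ∀ B ∈ S, B ∈ Bs) :
    ∃ T ⊆ S, (c * ∑ B ∈ S, Metric.ediam (cube Bs B)) + ∑ B ∈ T, Metric.ediam (cube Bs B) ≤
      μ (⋃ B ∈ T, cube Bs B) := by
  classical
  induction S using Finset.induction_on_max_value (fun B : HBall => B.radius) with
  | empty => exact ⟨∅, subset_rfl, by simp⟩
  | insert B S hBS hmax ih =>
    obtain ⟨T, hTS, hT⟩ := ih fun B' h => hSB B' (Finset.mem_insert_of_mem h)
    have hB : B ∈ Bs := hSB B (Finset.mem_insert_self _ _)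
    -- `T₁` collects the cubes swallowed by that of `B`, which has the largest radius so far; `T₂`
    -- collects those disjoint from it.
    set T₁ := T.filter fun B' => (cube Bs B' ∩ cube Bs B).Nonempty with hT₁
    set T₂ := T.filter fun B' => ¬ (cube Bs B' ∩ cube Bs B).Nonempty with hT₂
    have hmeas : ∀ B : HBall, MeasurableSet (cube Bs B) := measurableSet_cube hcount
    have hin : ∀ B' ∈ T₁, B' ∈ Bs ∧ B'.radius < B.radius ∧ cube Bs B' ⊆ cube Bs B := by
      intro B' h
      rw [hT₁, Finset.mem_filter] at h
      have hB'S := hTS h.1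
      have hB' := hSB B' (Finset.mem_insert_of_mem hB'S)
      exact ⟨hB', hS.cube_nested hB hB' (fun e => hBS (e ▸ hB'S)) (hmax B' hB'S) h.2⟩
    have hout : Disjoint (cube Bs B) (⋃ B' ∈ T₂, cube Bs B') := by
      rw [disjoint_iUnion₂_right]
      intro B' h
      rw [hT₂, Finset.mem_filter] at h
      exact (disjoint_iff_inter_eq_empty.2 (not_nonempty_iff_eq_empty.1 h.2)).symm
    have hsum : ∀ f : HBall → ENNReal, ∑ B' ∈ T, f B' = ∑ B' ∈ T₁, f B' + ∑ B' ∈ T₂, f B' :=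
      fun f => (Finset.sum_filter_add_sum_filter_not T _ f).symm
    have hunion : (⋃ B' ∈ T, cube Bs B') ⊆ (⋃ B' ∈ T₁, cube Bs B') ∪ ⋃ B' ∈ T₂, cube Bs B' := by
      intro z hz
      simp only [mem_iUnion, exists_prop] at hz
      obtain ⟨B', h, hz⟩ := hz
      by_cases hc : (cube Bs B' ∩ cube Bs B).Nonempty
      · exact Or.inl (mem_biUnion (Finset.mem_filter.2 ⟨h, hc⟩) hz)
      · exact Or.inr (mem_biUnion (Finset.mem_filter.2 ⟨h, hc⟩) hz)
    have hB₂ : B ∉ T₂ := fun h => hBS (hTS (Finset.mem_filter.1 h).1)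
    refine ⟨insert B T₂, Finset.insert_subset_insert _ ((Finset.filter_subset _ _).trans hTS), ?_⟩
    rw [Finset.sum_insert hBS, Finset.sum_insert hB₂, Finset.set_biUnion_insert,
      measure_union hout (Finset.measurableSet_biUnion _ fun B' _ => hmeas B')]
    have hfin : ∑ B' ∈ T₁, Metric.ediam (cube Bs B') ≠ ⊤ :=
      (ENNReal.sum_lt_top.2 fun B' h =>
        (hS.ediam_cube_le (hin B' h).1).trans_lt ENNReal.ofReal_lt_top).ne
    have hk := hkey B hB T₁ fun B' h => ⟨(hin B' h).1, (hin B' h).2.1⟩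
    have hsplit : μ (⋃ B' ∈ T₁, cube Bs B') + μ (cube Bs B \ ⋃ B' ∈ T₁, cube Bs B') =
        μ (cube Bs B) := by
      have := measure_inter_add_sdiff (μ := μ) (cube Bs B)
        (Finset.measurableSet_biUnion T₁ fun B' _ => hmeas B')
      rwa [inter_eq_self_of_subset_right (iUnion₂_subset fun B' h => (hin B' h).2.2)] at this
    rw [hsum] at hT
    have hT' := hT.trans ((measure_mono hunion).trans (measure_union_le _ _))
    -- The diameters over `T₁` occur in both the induction claim and `hkey`; being finite, their sum
    -- can be cancelled.
    rw [← ENNReal.add_le_add_iff_right hfin]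
    calc _ = (c * ∑ B ∈ S, Metric.ediam (cube Bs B) + (∑ B' ∈ T₁, Metric.ediam (cube Bs B') +
            ∑ B' ∈ T₂, Metric.ediam (cube Bs B'))) + (1 + c) * Metric.ediam (cube Bs B) := by ring
      _ ≤ _ := add_le_add hT' hk
      _ = _ := by
        rw [← hsplit]
        ring

theorem tsum_cubes_le {q : ℝ} {Bs : Set HBall} (hS : ScaleSeparated q Bs)
    (hcount : Bs.Countable) {μ : Measure Heis} {c : ENNReal}
    (hkey : ∀ B ∈ Bs, ∀ T : Finset HBall, (∀ B' ∈ T, B' ∈ Bs ∧ B'.radius < B.radius) →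
      (1 + c) * Metric.ediam (cube Bs B) ≤
        μ (cube Bs B \ ⋃ B' ∈ T, cube Bs B') + ∑ B' ∈ T, Metric.ediam (cube Bs B')) :
    c * ∑' Q : ↥(cubes Bs), Metric.ediam (Q : Set Heis) ≤ μ univ := by
  classical
  -- The sum over distinct cubes is at most the sum over balls, so coinciding cubes do no harm.
  have himage : ∑' Q : ↥(cubes Bs), Metric.ediam (Q : Set Heis) ≤
      ∑' B : ↥Bs, Metric.ediam (cube Bs B) := by
    let f : ↥Bs → ↥(cubes Bs) := fun B => ⟨cube Bs B, mem_image_of_mem _ B.2⟩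
    have hf : Function.Surjective f := by
      rintro ⟨_, B, hB, rfl⟩
      exact ⟨⟨B, hB⟩, rfl⟩
    exact ENNReal.tsum_le_tsum_comp_of_surjective hf fun Q : ↥(cubes Bs) => Metric.ediam (Q : Set Heis)
  refine (mul_le_mul_right himage c).trans ?_
  rw [ENNReal.tsum_eq_iSup_sum, ENNReal.mul_iSup]
  refine iSup_le fun S => ?_
  obtain ⟨T, -, hT⟩ := exists_disjoint_packing hS hcount hkey
    (S.map (Function.Embedding.subtype _)) fun B hB => by
      obtain ⟨B', -, rfl⟩ := Finset.mem_map.1 hB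
      exact B'.2
  rw [Finset.sum_map] at hT
  exact (le_self_add.trans hT).trans (measure_mono (subset_univ _))

/-! ### Length bounds from Lipschitz images -/

/-- A set whose image under a 1-Lipschitz function contains an interval has large measure, up to
the diameters of the sets removed from it. -/
theorem ofReal_le_hausdorffMeasure_diff_add {X ι : Type*} [MetricSpace X] [MeasurableSpace X]
    [BorelSpace X] {f : X → ℝ} (hf : LipschitzWith 1 f) {E : Set X} {a b : ℝ}
    (hab : Icc a b ⊆ f '' E) (Q : ι → Set X) (T : Finset ι) :
    ENNReal.ofReal (b - a) ≤ Measure.hausdorffMeasure 1 (E \ ⋃ j ∈ T, Q j) +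
      ∑ j ∈ T, Metric.ediam (Q j) := by
  have hsub : Icc a b ⊆ f '' (E \ ⋃ j ∈ T, Q j) ∪ ⋃ j ∈ T, f '' (Q j) := by
    intro t ht
    obtain ⟨x, hx, rfl⟩ := hab ht
    by_cases h : x ∈ ⋃ j ∈ T, Q j
    · simp only [mem_iUnion, exists_prop] at h
      obtain ⟨j, hj, hxj⟩ := h
      exact Or.inr (mem_biUnion hj (mem_image_of_mem f hxj))
    · exact Or.inl (mem_image_of_mem f ⟨hx, h⟩)
  rw [← Real.volume_Icc]
  refine (measure_mono hsub).trans ((measure_union_le _ _).trans (add_le_add ?_ ?_))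
  · rw [← hausdorffMeasure_real]
    simpa using hf.hausdorffMeasure_image_le zero_le_one (E \ ⋃ j ∈ T, Q j)
  · refine (measure_biUnion_finset_le _ _).trans (Finset.sum_le_sum fun j _ => ?_)
    refine (Real.volume_le_diam _).trans ?_
    simpa using hf.ediam_image_le (Q j)

/-- The one-piece bound is applied to `E` with the sets `Q j` that meet `E`, and to `E'` with those
that meet only `E'`. No `Q j` with `j ∈ T` meets both, so each diameter is spent at most once. -/
theorem ofReal_add_ofReal_le {X ι : Type*} [MetricSpace X] [MeasurableSpace X]
    [BorelSpace X] {f f' : X → ℝ} (hf : LipschitzWith 1 f) (hf' : LipschitzWith 1 f')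
    {E E' W Γ : Set X} {a b a' b' : ℝ} (hab : Icc a b ⊆ f '' E) (hab' : Icc a' b' ⊆ f' '' E')
    (hE : E ⊆ Γ ∩ W) (hE' : E' ⊆ Γ ∩ W) (hEE : Disjoint E E') (hmeas : MeasurableSet E')
    (hΓ : MeasurableSet Γ) {Q : ι → Set X} (hQ : ∀ j, MeasurableSet (Q j)) (T : Finset ι)
    (hT : ∀ j ∈ T, ¬ ((Q j ∩ E).Nonempty ∧ (Q j ∩ E').Nonempty)) :
    ENNReal.ofReal (b - a) + ENNReal.ofReal (b' - a') ≤
      (Measure.hausdorffMeasure 1).restrict Γ (W \ ⋃ j ∈ T, Q j) +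
        ∑ j ∈ T, Metric.ediam (Q j) := by
  classical
  set U := ⋃ j ∈ T, Q j with hU
  have hUm : MeasurableSet U := Finset.measurableSet_biUnion _ fun j _ => hQ j
  have h1 := ofReal_le_hausdorffMeasure_diff_add hf hab Q (T.filter fun j => (Q j ∩ E).Nonempty)
  have h2 := ofReal_le_hausdorffMeasure_diff_add hf' hab' Q
    (T.filter fun j => ¬ (Q j ∩ E).Nonempty ∧ (Q j ∩ E').Nonempty)
  have e1 : E \ ⋃ j ∈ T.filter fun j => (Q j ∩ E).Nonempty, Q j ⊆ E \ U := by
    rintro x ⟨hx, hxn⟩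
    refine ⟨hx, fun hxU => hxn ?_⟩
    simp only [hU, mem_iUnion, exists_prop] at hxU
    obtain ⟨j, hj, hxj⟩ := hxU
    exact mem_biUnion (Finset.mem_filter.2 ⟨hj, x, hxj, hx⟩) hxj
  have e2 : E' \ ⋃ j ∈ T.filter fun j => ¬ (Q j ∩ E).Nonempty ∧ (Q j ∩ E').Nonempty, Q j ⊆
      E' \ U := by
    rintro x ⟨hx, hxn⟩
    refine ⟨hx, fun hxU => hxn ?_⟩
    simp only [hU, mem_iUnion, exists_prop] at hxU
    obtain ⟨j, hj, hxj⟩ := hxU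
    exact mem_biUnion (Finset.mem_filter.2 ⟨hj, fun hc => hT j hj ⟨hc, x, hxj, hx⟩, x, hxj, hx⟩) hxj
  have hsum : ∑ j ∈ T.filter (fun j => (Q j ∩ E).Nonempty), Metric.ediam (Q j) +
      ∑ j ∈ T.filter (fun j => ¬ (Q j ∩ E).Nonempty ∧ (Q j ∩ E').Nonempty), Metric.ediam (Q j) ≤
      ∑ j ∈ T, Metric.ediam (Q j) := by
    rw [← Finset.sum_filter_add_sum_filter_not T (fun j => (Q j ∩ E).Nonempty)]
    gcongr with j
    exact fun h => h.1
  have hμ : Measure.hausdorffMeasure 1 (E \ U) + Measure.hausdorffMeasure 1 (E' \ U) ≤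
      (Measure.hausdorffMeasure 1).restrict Γ (W \ U) := by
    rw [← measure_union (hEE.mono sdiff_subset sdiff_subset) (hmeas.diff hUm),
      Measure.restrict_apply' hΓ]
    refine measure_mono ?_
    rintro x (⟨hx, hn⟩ | ⟨hx, hn⟩)
    · exact ⟨⟨(hE hx).2, hn⟩, (hE hx).1⟩
    · exact ⟨⟨(hE' hx).2, hn⟩, (hE' hx).1⟩
  calc _ ≤ _ := add_le_add (h1.trans (add_le_add_left (measure_mono e1) _))
        (h2.trans (add_le_add_left (measure_mono e2) _))
    _ = _ := add_add_add_comm _ _ _ _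
    _ ≤ _ := add_le_add hμ hsum

/-! ### Coordinates along horizontal lines -/

namespace Heis

theorem sq_add_sq_le_dist_sq (g h : Heis) :
    (h.x - g.x) ^ 2 + (h.y - g.y) ^ 2 ≤ dist g h ^ 2 := by
  have h4 := N_pow_four (g⁻¹ * h)
  rw [← dist_def] at h4
  simp only [mul_x, mul_y, inv_x, inv_y] at h4
  have he := eta_pos
  have h5 : ((h.x - g.x) ^ 2 + (h.y - g.y) ^ 2) ^ 2 ≤ (dist g h ^ 2) ^ 2 := by
    have : 0 ≤ eta * (g⁻¹ * h).z ^ 2 := by positivity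
    nlinarith
  exact abs_le_of_sq_le_sq' h5 (by positivity) |>.2

theorem N_sq_of_z_eq_zero {g : Heis} (h : g.z = 0) : N g ^ 2 = g.x ^ 2 + g.y ^ 2 := by
  have h4 := N_pow_four g
  rw [h] at h4
  refine (sq_eq_sq₀ (by positivity) (by positivity)).1 ?_
  linear_combination h4

/-- The twisting term of the product vanishes for parallel horizontal vectors, so horizontal lines
are copies of `ℝ`. -/
theorem inv_mul_of_horizontal (a h : Heis) (hz : h.z = 0) (s t : ℝ) :
    (a * dil s h)⁻¹ * (a * dil t h) = dil (t - s) h := by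
  ext <;> simp [dil, hz] <;> ring

/-- The coordinate of the horizontal projection along the direction `(u, v)`, measured
from `a`. -/
def lineCoord (a : Heis) (u v : ℝ) (g : Heis) : ℝ := (g.x - a.x) * u + (g.y - a.y) * v

theorem lineCoord_self (a : Heis) (u v : ℝ) : lineCoord a u v a = 0 := by simp [lineCoord]

theorem lipschitzWith_lineCoord {u v : ℝ} (huv : u ^ 2 + v ^ 2 = 1) (a : Heis) :
    LipschitzWith 1 (lineCoord a u v) := by
  refine LipschitzWith.of_dist_le_mul fun g h => ?_
  rw [NNReal.coe_one, one_mul, Real.dist_eq]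
  refine abs_le_of_sq_le_sq ?_ dist_nonneg
  refine le_trans ?_ (sq_add_sq_le_dist_sq g h)
  simp only [lineCoord]
  have h1 := sq_nonneg ((h.x - g.x) * v - (h.y - g.y) * u)
  have : ((g.x - a.x) * u + (g.y - a.y) * v - ((h.x - a.x) * u + (h.y - a.y) * v)) ^ 2 =
      ((h.x - g.x) ^ 2 + (h.y - g.y) ^ 2) * (u ^ 2 + v ^ 2) -
        ((h.x - g.x) * v - (h.y - g.y) * u) ^ 2 := by ring
  rw [this, huv]
  linarith

theorem abs_lineCoord_sub_le {u v : ℝ} (huv : u ^ 2 + v ^ 2 = 1) (a g h : Heis) :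
    |lineCoord a u v g - lineCoord a u v h| ≤ dist g h := by
  have := (lipschitzWith_lineCoord huv a).dist_le_mul g h
  rwa [NNReal.coe_one, one_mul, Real.dist_eq] at this

theorem lineCoord_mul_dil {u v : ℝ} (huv : u ^ 2 + v ^ 2 = 1) (a : Heis) (m t : ℝ) :
    lineCoord a u v (a * dil t ⟨m * u, m * v, 0⟩) = t * m := by
  simp only [lineCoord, mul_x, mul_y, dil]
  linear_combination t * m * huv

theorem dist_mul_dil {u v : ℝ} (huv : u ^ 2 + v ^ 2 = 1) (a : Heis) (m s t : ℝ) :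
    dist (a * dil s ⟨m * u, m * v, 0⟩) (a * dil t ⟨m * u, m * v, 0⟩) = |s * m - t * m| := by
  rw [dist_def, inv_mul_of_horizontal a _ rfl]
  have h := N_sq_of_z_eq_zero (g := dil (t - s) ⟨m * u, m * v, 0⟩) (by simp [dil])
  rw [← abs_of_nonneg (N_nonneg _)]
  refine (sq_eq_sq_iff_abs_eq_abs _ _).1 ?_
  rw [h]
  simp only [dil]
  linear_combination ((t - s) * m) ^ 2 * huv

/-- Near a horizontal line, distances are almost recovered from the coordinate on the line. -/
theorem dist_le_abs_lineCoord_sub_add {u v : ℝ} (huv : u ^ 2 + v ^ 2 = 1) (a : Heis) {m s t ε : ℝ}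
    {g h : Heis} (hg : dist g (a * dil s ⟨m * u, m * v, 0⟩) ≤ ε)
    (hh : dist h (a * dil t ⟨m * u, m * v, 0⟩) ≤ ε) :
    dist g h ≤ |lineCoord a u v g - lineCoord a u v h| + 4 * ε := by
  have h1 := abs_le.1 ((abs_lineCoord_sub_le huv a _ _).trans hg)
  have h2 := abs_le.1 ((abs_lineCoord_sub_le huv a _ _).trans hh)
  rw [lineCoord_mul_dil huv] at h1 h2
  have h3 := dist_triangle4 g (a * dil s ⟨m * u, m * v, 0⟩) (a * dil t ⟨m * u, m * v, 0⟩) h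
  rw [dist_mul_dil huv, dist_comm (a * dil t _) h] at h3
  have h4 : |s * m - t * m| ≤ |lineCoord a u v g - lineCoord a u v h| + 2 * ε := by
    rw [abs_le]
    have := le_abs_self (lineCoord a u v g - lineCoord a u v h)
    have := neg_abs_le (lineCoord a u v g - lineCoord a u v h)
    constructor <;> linarith [h1.1, h1.2, h2.1, h2.2]
  linarith

/-- Two opposite points on the horizontal line through the center in the `x`-direction are at
distance exactly `2r`. -/
theorem two_mul_le_diam_closedBall (x : Heis) {r : ℝ} (hr : 0 ≤ r) :
    2 * r ≤ Metric.diam (Metric.closedBall x r) := by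
  have h1 : (1 : ℝ) ^ 2 + (0 : ℝ) ^ 2 = 1 := by norm_num
  have h0 := dist_mul_dil h1 x 1 0
  have hx : x * dil 0 ⟨1 * 1, 1 * 0, 0⟩ = x := by ext <;> simp [dil]
  rw [hx] at h0
  have hm : ∀ t : ℝ, |t| ≤ r → x * dil t ⟨1 * 1, 1 * 0, 0⟩ ∈ Metric.closedBall x r := by
    intro t ht
    rw [Metric.mem_closedBall, dist_comm, h0]
    simpa using ht
  have h2 := Metric.dist_le_diam_of_mem Metric.isBounded_closedBall
    (hm (-r) (by rw [abs_neg, abs_of_nonneg hr])) (hm r (abs_of_nonneg hr).le)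
  rw [dist_mul_dil h1] at h2
  refine le_trans (le_of_eq ?_) h2
  rw [abs_of_nonpos (by linarith)]
  ring

end Heis

open Heis

/-- Every horizontal direction `(x, y, 0)` with `(x, y) ≠ 0` is a multiple of a unit one. -/
theorem exists_unit_direction {h : Heis} (hz : h.z = 0) (hne : h ≠ 1) :
    ∃ m u v : ℝ, 0 < m ∧ u ^ 2 + v ^ 2 = 1 ∧ h = ⟨m * u, m * v, 0⟩ := by
  have hs : 0 < h.x ^ 2 + h.y ^ 2 := by
    by_contra hcon
    refine hne (Heis.ext ?_ ?_ hz)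
    · simp only [one_x]; nlinarith [sq_nonneg h.x, sq_nonneg h.y]
    · simp only [one_y]; nlinarith [sq_nonneg h.x, sq_nonneg h.y]
  have hm := Real.sqrt_pos.2 hs
  have hm2 := Real.sq_sqrt hs.le
  refine ⟨√(h.x ^ 2 + h.y ^ 2), h.x / √(h.x ^ 2 + h.y ^ 2), h.y / √(h.x ^ 2 + h.y ^ 2), hm, ?_, ?_⟩
  · rw [div_pow, div_pow, ← add_div, hm2, div_self hs.ne']
  · ext
    · field_simp
    · field_simp
    · exact hz

/-- If `β_Γ(B)` is at least `β`, then each horizontal line is missed by a point of `Γ ∩ B` by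
a definite amount. -/
theorem exists_far_point {Γ : Set Heis} {B : HBall} (hr : 0 < B.radius) {β : ℝ} (hβ : 0 < β)
    (h : β ≤ betaBall Γ B) {L : Set Heis} (hL : IsHorizontalLine L) :
    ∃ z ∈ Γ ∩ B.toSet, β * B.radius ≤ Metric.infDist z L := by
  by_contra! hcon
  have hd := two_mul_le_diam_closedBall B.center hr.le
  -- Dividing by `diam B ≥ 2r` gains a factor `2`, which keeps the contradiction strict after taking
  -- a supremum.
  have hle : betaBall Γ B ≤ β / 2 := by
    refine (ciInf_le ⟨0, ?_⟩ (⟨L, hL⟩ : {L : Set Heis // IsHorizontalLine L})).trans ?_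
    · rintro _ ⟨L', rfl⟩
      exact Real.iSup_nonneg fun x => div_nonneg Metric.infDist_nonneg Metric.diam_nonneg
    · refine Real.iSup_le (fun x => ?_) (by positivity)
      change Metric.infDist _ L / Metric.diam (Metric.closedBall B.center B.radius) ≤ _
      rw [div_le_iff₀ (by linarith)]
      nlinarith [hcon x x.2]
  linarith

/-! ## Components and arcs on the circle -/

section Circle

variable {p : ℝ} {γ : AddCircle p → Heis}

/-- The closure of the component of `t₀` in `γ⁻¹(Q)` is an arc, whose end points are mapped at
distance at least `R` from `γ(t₀)` when `Q` contains the ball of radius `R` around `γ(t₀)`. -/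
theorem exists_component_arc (hp : 0 < p) (hγ : Continuous γ) {Q : Set Heis} {R : ℝ} (hR : 0 < R)
    (t₀ : AddCircle p) (hball : Metric.ball (γ t₀) R ⊆ Q) (hout : ∃ t, γ t ∉ Q) :
    ∃ (τ : Arc p) (t₁ s₀ t₂ : ℝ), t₁ < s₀ ∧ s₀ < t₂ ∧ (s₀ : AddCircle p) = t₀ ∧
      τ.carrier = (fun s : ℝ => (s : AddCircle p)) '' Icc t₁ t₂ ∧
      τ.carrier = closure (connectedComponentIn (γ ⁻¹' Q) t₀) ∧
      R ≤ dist (γ t₀) (γ t₁) ∧ R ≤ dist (γ t₀) (γ t₂) := by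
  have : Fact (0 < p) := ⟨hp⟩
  obtain ⟨t, ht⟩ := hout
  obtain ⟨a, rfl⟩ := QuotientAddGroup.mk_surjective t
  have hcoe : Continuous (fun s : ℝ => (s : AddCircle p)) := AddCircle.continuous_mk' p
  have ht₀Q : t₀ ∈ γ ⁻¹' Q := hball (Metric.mem_ball_self hR)
  set C := connectedComponentIn (γ ⁻¹' Q) t₀ with hC
  have hCQ : C ⊆ γ ⁻¹' Q := connectedComponentIn_subset _ _
  have haC : (a : AddCircle p) ∉ C := fun h => ht (hCQ h)
  -- The circle is cut at a point mapped outside `Q`; the component avoids it and lifts to an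
  -- interval `I` of the line.
  set e := AddCircle.openPartialHomeomorphCoe p a with he
  set I : Set ℝ := {s | s ∈ Ioo a (a + p) ∧ (s : AddCircle p) ∈ C} with hI
  have himg : I = e.symm '' C := by
    ext s
    constructor
    · rintro ⟨hs, hsC⟩
      exact ⟨s, hsC, e.left_inv hs⟩
    · rintro ⟨y, hy, rfl⟩
      have hy' : y ∈ e.target := fun h => haC (h ▸ hy)
      refine ⟨e.map_target hy', ?_⟩
      have : ((e.symm y : ℝ) : AddCircle p) = y := e.right_inv hy'
      rwa [this]
  have hIpre : IsPreconnected I := by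
    rw [himg]
    refine isPreconnected_connectedComponentIn.image _ (e.continuousOn_symm.mono ?_)
    exact fun y hy h => haC (h ▸ hy)
  have hCI : C ⊆ (fun s : ℝ => (s : AddCircle p)) '' I := by
    intro y hy
    have hy' : y ∈ e.target := fun h => haC (h ▸ hy)
    have : ((e.symm y : ℝ) : AddCircle p) = y := e.right_inv hy'
    exact ⟨e.symm y, ⟨e.map_target hy', by rwa [this]⟩, this⟩
  obtain ⟨s₀, hs₀, hs₀t⟩ := hCI (mem_connectedComponentIn ht₀Q)
  have hIsub : I ⊆ Icc a (a + p) := fun s hs => Ioo_subset_Icc_self hs.1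
  have hbelow : BddBelow I := ⟨a, fun s hs => (hIsub hs).1⟩
  have habove : BddAbove I := ⟨a + p, fun s hs => (hIsub hs).2⟩
  have hne : I.Nonempty := ⟨s₀, hs₀⟩
  -- `Q` itself need not be open. Only at points mapped into the ball of radius `R` can the
  -- component be extended to both sides, so neither `sInf I` nor `sSup I` is such a point.
  have hnhds : ∀ s ∈ closure I, γ s ∈ Metric.ball (γ t₀) R → ∃ ε > 0, Ioo (s - ε) (s + ε) ⊆ I := by
    intro s hs hsb
    have hs' : s ∈ Icc a (a + p) := closure_minimal hIsub isClosed_Icc hs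
    have hsa : s ∈ Ioo a (a + p) := by
      refine ⟨hs'.1.lt_of_ne ?_, hs'.2.lt_of_ne ?_⟩
      · rintro rfl
        exact ht (hball hsb)
      · rintro rfl
        rw [AddCircle.coe_add_period] at hsb
        exact ht (hball hsb)
    have hopen : IsOpen (Ioo a (a + p) ∩ (fun s : ℝ => γ s) ⁻¹' Metric.ball (γ t₀) R) :=
      isOpen_Ioo.inter (Metric.isOpen_ball.preimage (hγ.comp hcoe))
    obtain ⟨ε, hε, hεsub⟩ := Metric.isOpen_iff.1 hopen s ⟨hsa, hsb⟩
    rw [Real.ball_eq_Ioo] at hεsub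
    refine ⟨ε, hε, fun w hw => ⟨(hεsub hw).1, ?_⟩⟩
    obtain ⟨w', hw', hw'I⟩ := mem_closure_iff.1 hs _ isOpen_Ioo
      (⟨by linarith, by linarith⟩ : s ∈ Ioo (s - ε) (s + ε))
    have hsub : (fun s : ℝ => (s : AddCircle p)) '' Ioo (s - ε) (s + ε) ⊆ γ ⁻¹' Q := by
      rintro _ ⟨w, hw, rfl⟩
      exact hball (hεsub hw).2
    have := (isPreconnected_Ioo.image _ hcoe.continuousOn).subset_connectedComponentIn
      (mem_image_of_mem _ hw') hsub
    rw [hC, connectedComponentIn_eq hw'I.2]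
    exact this (mem_image_of_mem _ hw)
  have hlow : R ≤ dist (γ t₀) (γ (sInf I : ℝ)) := by
    by_contra! hcon
    rw [dist_comm] at hcon
    obtain ⟨ε, hε, hsub⟩ := hnhds _ (csInf_mem_closure hne hbelow) hcon
    have := csInf_le hbelow (hsub (⟨by linarith, by linarith⟩ :
      sInf I - ε / 2 ∈ Ioo (sInf I - ε) (sInf I + ε)))
    linarith
  have hupp : R ≤ dist (γ t₀) (γ (sSup I : ℝ)) := by
    by_contra! hcon
    rw [dist_comm] at hcon
    obtain ⟨ε, hε, hsub⟩ := hnhds _ (csSup_mem_closure hne habove) hcon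
    have := le_csSup habove (hsub (⟨by linarith, by linarith⟩ :
      sSup I + ε / 2 ∈ Ioo (sSup I - ε) (sSup I + ε)))
    linarith
  have hl : sInf I < s₀ := by
    refine (csInf_le hbelow hs₀).lt_of_ne fun h => ?_
    rw [h] at hlow
    change R ≤ dist (γ t₀) (γ ((fun s : ℝ => (s : AddCircle p)) s₀)) at hlow
    rw [hs₀t, dist_self] at hlow
    linarith
  have hu : s₀ < sSup I := by
    refine (le_csSup habove hs₀).lt_of_ne fun h => ?_
    rw [← h] at hupp
    change R ≤ dist (γ t₀) (γ ((fun s : ℝ => (s : AddCircle p)) s₀)) at hupp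
    rw [hs₀t, dist_self] at hupp
    linarith
  have hIoo : Ioo (sInf I) (sSup I) ⊆ I := IsConnected.Ioo_csInf_csSup_subset ⟨hne, hIpre⟩ hbelow habove
  have hcl : (fun s : ℝ => (s : AddCircle p)) '' Icc (sInf I) (sSup I) = closure C := by
    apply Subset.antisymm
    · rw [← closure_Ioo (hl.trans hu).ne]
      refine (image_closure_subset_closure_image hcoe).trans (closure_mono ?_)
      rintro _ ⟨s, hs, rfl⟩
      exact (hIoo hs).2
    · refine closure_minimal ?_ (isCompact_Icc.image hcoe).isClosed
      refine hCI.trans (image_mono fun s hs => ⟨csInf_le hbelow hs, le_csSup habove hs⟩)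
  have hlen : sSup I - sInf I ≤ p := by
    have h1 := csSup_le hne fun s hs => (hIsub hs).2
    have h2 := le_csInf hne fun s hs => (hIsub hs).1
    linarith
  have hcar : (⟨(sInf I : ℝ), sSup I - sInf I, by linarith, hlen⟩ : Arc p).carrier =
      (fun s : ℝ => (s : AddCircle p)) '' Icc (sInf I) (sSup I) := by
    have : (fun s : ℝ => ((sInf I : ℝ) : AddCircle p) + (s : AddCircle p)) =
        (fun s : ℝ => (s : AddCircle p)) ∘ fun s => sInf I + s := by
      funext s
      simp
    rw [Arc.carrier, this, image_comp, image_const_add_Icc]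
    simp
  exact ⟨_, sInf I, s₀, sSup I, hl, hu, hs₀t, hcar, hcar.trans hcl, hlow, hupp⟩

/-- An arc which contains the image of `[t₁, t₂]` and is not the whole circle lifts to an interval
around `[t₁, t₂]`. -/
theorem Arc.exists_lift (τ : Arc p) (hlen : τ.len < p) {t₁ t₂ : ℝ} (h12 : t₁ ≤ t₂)
    (hsub : (fun s : ℝ => (s : AddCircle p)) '' Icc t₁ t₂ ⊆ τ.carrier) :
    ∃ u v : ℝ, u ≤ t₁ ∧ t₂ ≤ v ∧ v < u + p ∧ (u : AddCircle p) = τ.src ∧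
      (v : AddCircle p) = τ.tgt ∧ τ.carrier = (fun s : ℝ => (s : AddCircle p)) '' Icc u v := by
  have : Fact (0 < p) := ⟨τ.len_pos.trans hlen⟩
  obtain ⟨s, hs, hst⟩ := hsub (mem_image_of_mem _ (left_mem_Icc.2 h12))
  have hu : ((t₁ - s : ℝ) : AddCircle p) = τ.src := by
    rw [AddCircle.coe_sub]
    exact sub_eq_of_eq_add hst.symm
  have hcar : τ.carrier = (fun s : ℝ => (s : AddCircle p)) '' Icc (t₁ - s) (t₁ - s + τ.len) := by
    have : (fun s : ℝ => τ.src + (s : AddCircle p)) =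
        (fun s : ℝ => (s : AddCircle p)) ∘ fun w => t₁ - s + w := by
      funext w
      rw [← hu]
      simp
    rw [Arc.carrier, this, image_comp, image_const_add_Icc]
    simp
  have := τ.len_pos
  refine ⟨t₁ - s, t₁ - s + τ.len, by linarith [hs.1], ?_, by linarith, hu, ?_, hcar⟩
  -- If the lift stopped before `t₂`, a parameter just past its end, within the same period, would
  -- represent a point of the arc, against injectivity on a period.
  · by_contra! hlt
    obtain ⟨w, hw1, hw2⟩ := exists_between (lt_min hlt
      (by linarith : t₁ - s + τ.len < t₁ - s + p))
    have hw3 := lt_min_iff.1 hw2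
    rw [hcar] at hsub
    obtain ⟨w', hw', hww⟩ := hsub (mem_image_of_mem _
      (⟨by linarith [hs.2], hw3.1.le⟩ : w ∈ Icc t₁ t₂))
    have := (AddCircle.coe_eq_coe_iff_of_mem_Ico (p := p) (a := t₁ - s)
      ⟨hw'.1, by linarith [hw'.2]⟩ ⟨by linarith, hw3.2⟩).1 hww
    linarith [hw'.2]
  · rw [Arc.tgt, ← hu, AddCircle.coe_add]

/-- The pieces `[u, t₁)` and `(t₂, v]` are connected and, as `v < u + p`, miss the inner arc. Each
lies in one component of the difference, and continuity reaches the missing end point. -/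
theorem dist_endpoints_le (hp : 0 < p) (hγ : Continuous γ) {u t₁ t₂ v d : ℝ} (hd : 0 ≤ d)
    (h1 : u ≤ t₁) (h12 : t₁ ≤ t₂) (h2 : t₂ ≤ v) (hv : v < u + p)
    (hcomp : ∀ t ∈ (fun s : ℝ => (s : AddCircle p)) '' Icc u v \
        (fun s : ℝ => (s : AddCircle p)) '' Icc t₁ t₂,
      Metric.diam (γ '' connectedComponentIn ((fun s : ℝ => (s : AddCircle p)) '' Icc u v \
        (fun s : ℝ => (s : AddCircle p)) '' Icc t₁ t₂) t) < d) :
    dist (γ u) (γ t₁) ≤ d ∧ dist (γ v) (γ t₂) ≤ d := by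
  have : Fact (0 < p) := ⟨hp⟩
  have hcoe : Continuous (fun s : ℝ => (s : AddCircle p)) := AddCircle.continuous_mk' p
  set W := (fun s : ℝ => (s : AddCircle p)) '' Icc u v \
        (fun s : ℝ => (s : AddCircle p)) '' Icc t₁ t₂ with hW
  have hmem : ∀ s ∈ Icc u v, s ∉ Icc t₁ t₂ → (s : AddCircle p) ∈ W := by
    intro s hs hn
    refine ⟨mem_image_of_mem _ hs, ?_⟩
    rintro ⟨w, hw, hws⟩
    have := (AddCircle.coe_eq_coe_iff_of_mem_Ico (p := p) (a := u)
      ⟨by linarith [hw.1], by linarith [hw.2]⟩ ⟨hs.1, by linarith [hs.2]⟩).1 hws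
    exact hn (this ▸ hw)
  have hpair : ∀ S : Set ℝ, IsPreconnected S → (∀ s ∈ S, s ∈ Icc u v ∧ s ∉ Icc t₁ t₂) →
      ∀ w ∈ S, ∀ s ∈ closure S, dist (γ w) (γ s) ≤ d := by
    intro S hS hSW w hw s hs
    have hw' := hmem w (hSW w hw).1 (hSW w hw).2
    have hsub := (hS.image _ hcoe.continuousOn).subset_connectedComponentIn (F := W)
      (mem_image_of_mem _ hw) (by
        rintro _ ⟨s, hs, rfl⟩
        exact hmem s (hSW s hs).1 (hSW s hs).2)
    have hbdd : Bornology.IsBounded (γ '' connectedComponentIn W (w : AddCircle p)) :=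
      (isCompact_range hγ).isBounded.subset (image_subset_range _ _)
    have hcl : IsClosed {s : ℝ | dist (γ w) (γ s) ≤ d} :=
      isClosed_le (continuous_const.dist (hγ.comp hcoe)) continuous_const
    refine closure_minimal (fun s hs => ?_) hcl hs
    exact (Metric.dist_le_diam_of_mem hbdd (mem_image_of_mem γ (hsub (mem_image_of_mem _ hw)))
      (mem_image_of_mem γ (hsub (mem_image_of_mem _ hs)))).trans (hcomp _ hw').le
  constructor
  · rcases h1.eq_or_lt with rfl | h1
    · simpa using hd
    · refine hpair (Ico u t₁) isPreconnected_Ico (fun s hs => ⟨⟨hs.1, by linarith [hs.2]⟩,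
        fun h => by linarith [h.1, hs.2]⟩) u ⟨le_rfl, h1⟩ t₁ ?_
      rw [closure_Ico h1.ne]
      exact right_mem_Icc.2 h1.le
  · rcases h2.eq_or_lt with rfl | h2
    · simpa using hd
    · refine hpair (Ioc t₂ v) isPreconnected_Ioc (fun s hs => ⟨⟨by linarith [hs.1], hs.2⟩,
        fun h => by linarith [h.2, hs.1]⟩) v ⟨h2, le_rfl⟩ t₂ ?_
      rw [closure_Ioc h2.ne]
      exact left_mem_Icc.2 h2.le

theorem Arc.src_mem_carrier (τ : Arc p) : τ.src ∈ τ.carrier :=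
  ⟨0, left_mem_Icc.2 τ.len_pos.le, by simp⟩

/-- Points of an arc with small `β` are close to the segment of the arc. -/
theorem Arc.exists_close_point (hp : 0 < p) (hγ : Continuous γ) (τ : Arc p) {b d : ℝ} (hb : 0 < b)
    (hd : 0 < d) (hβ : τ.beta γ < b) (hdiam : τ.diam γ ≤ d) {t : AddCircle p}
    (ht : t ∈ τ.carrier) :
    ∃ σ ∈ Icc (0 : ℝ) 1, dist (γ t)
      (γ τ.src * dil σ (proj ((γ τ.src)⁻¹ * γ τ.tgt))) ≤ b * d := by
  have : Fact (0 < p) := ⟨hp⟩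
  have hsrc : γ τ.src ∈ horSegment (γ τ.src) (γ τ.tgt) :=
    ⟨0, by simp, by ext <;> simp [dil, proj]⟩
  have hbdd : Bornology.IsBounded (γ '' τ.carrier) :=
    (isCompact_range hγ).isBounded.subset (image_subset_range _ _)
  have hle : ∀ t ∈ τ.carrier,
      Metric.infDist (γ t) (horSegment (γ τ.src) (γ τ.tgt)) ≤ τ.diam γ := fun t ht =>
    (Metric.infDist_le_dist_of_mem hsrc).trans
      (Metric.dist_le_diam_of_mem hbdd (mem_image_of_mem γ ht) (mem_image_of_mem γ τ.src_mem_carrier))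
  have h0 : 0 ≤ τ.diam γ := Metric.diam_nonneg
  have hlt : Metric.infDist (γ t) (horSegment (γ τ.src) (γ τ.tgt)) < b * d := by
    rcases h0.eq_or_lt with h | h
    -- If the arc has diameter zero, `β(τ)` divides by zero and carries no information, but then the
    -- distance to the segment is zero anyway.
    · exact (hle t ht).trans_lt (h ▸ by positivity)
    · have hβt : Metric.infDist (γ t) (horSegment (γ τ.src) (γ τ.tgt)) / τ.diam γ ≤ τ.beta γ := by
        refine le_ciSup (f := fun t : ↥τ.carrier =>
          Metric.infDist (γ t) (horSegment (γ τ.src) (γ τ.tgt)) / τ.diam γ) ⟨1, ?_⟩ ⟨t, ht⟩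
        rintro _ ⟨t, rfl⟩
        exact (div_le_one h).2 (hle t t.2)
      have := (div_lt_iff₀ h).1 (hβt.trans_lt hβ)
      exact this.trans_le (mul_le_mul_of_nonneg_left hdiam hb.le)
  obtain ⟨y, ⟨σ, hσ, rfl⟩, hy⟩ := (Metric.infDist_lt_iff ⟨_, hsrc⟩).1 hlt
  exact ⟨σ, hσ, hy.le⟩

end Circle

/-! ### Crossing a ball along a segment -/

/-- A curve which runs close to a segment and leaves the ball of radius `R` around one of its
points near both of its ends crosses this ball along the segment. -/
theorem exists_flat_crossing {g : ℝ → Heis} (hg : Continuous g) {u t₁ s₀ t₂ v R d η : ℝ}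
    (h1 : u ≤ t₁) (hs₁ : t₁ < s₀) (hs₂ : s₀ < t₂) (h2 : t₂ ≤ v)
    (hR₁ : R ≤ dist (g s₀) (g t₁)) (hR₂ : R ≤ dist (g s₀) (g t₂))
    (hd₁ : dist (g u) (g t₁) ≤ d) (hd₂ : dist (g v) (g t₂) ≤ d)
    (hclose : ∀ s ∈ Icc u v, ∃ σ ∈ Icc (0 : ℝ) 1,
      dist (g s) (g u * dil σ (proj ((g u)⁻¹ * g v))) ≤ η) (hsmall : 5 * η + d < R) :
    ∃ (L : Set Heis) (f : Heis → ℝ), IsHorizontalLine L ∧ LipschitzWith 1 f ∧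
      (∀ s ∈ Icc u v, Metric.infDist (g s) L ≤ η) ∧
      Icc (f (g s₀) - (R - 4 * η)) (f (g s₀) + (R - 4 * η)) ⊆
        f '' (g '' Icc u v ∩ Metric.closedBall (g s₀) R) := by
  have hu : u ∈ Icc u v := ⟨le_rfl, by linarith⟩
  have hs : s₀ ∈ Icc u v := ⟨by linarith, by linarith⟩
  have ht₁ : t₁ ∈ Icc u v := ⟨h1, by linarith⟩
  have ht₂ : t₂ ∈ Icc u v := ⟨by linarith, h2⟩
  have hd0 : 0 ≤ d := dist_nonneg.trans hd₁
  have hη : 0 ≤ η := by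
    obtain ⟨σ, -, h⟩ := hclose u hu
    exact dist_nonneg.trans h
  -- A degenerate segment would keep the whole curve within `η` of `g u`, although `g s₀` and `g t₁`
  -- are at least `R > 2η` apart.
  have hne : proj ((g u)⁻¹ * g v) ≠ 1 := by
    intro hone
    have hall : ∀ s ∈ Icc u v, dist (g s) (g u) ≤ η := by
      intro s hs
      obtain ⟨σ, -, h⟩ := hclose s hs
      have e : g u * dil σ (proj ((g u)⁻¹ * g v)) = g u := by
        rw [hone]
        ext <;> simp [dil]
      rwa [e] at h
    have := dist_triangle_right (g s₀) (g t₁) (g u)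
    linarith [hall _ hs, hall _ ht₁]
  obtain ⟨m, a, b, hm, hab, hh⟩ := exists_unit_direction
    (rfl : (proj ((g u)⁻¹ * g v)).z = 0) hne
  have hPv : lineCoord (g u) a b (g v) = m := by
    have hx := congrArg Heis.x hh
    have hy := congrArg Heis.y hh
    simp only [proj, mul_x, mul_y, inv_x, inv_y] at hx hy
    simp only [lineCoord]
    linear_combination a * hx + b * hy + m * hab
  rw [hh] at hclose hne
  have hP : ∀ s ∈ Icc u v, -η ≤ lineCoord (g u) a b (g s) ∧ lineCoord (g u) a b (g s) ≤ m + η := by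
    intro s hs
    obtain ⟨σ, hσ, h⟩ := hclose s hs
    have := abs_le.1 ((abs_lineCoord_sub_le hab (g u) _ _).trans h)
    rw [lineCoord_mul_dil hab] at this
    constructor
    · nlinarith [hσ.1]
    · nlinarith [hσ.2]
  have hdist : ∀ s ∈ Icc u v, ∀ t ∈ Icc u v, dist (g s) (g t) ≤
      |lineCoord (g u) a b (g s) - lineCoord (g u) a b (g t)| + 4 * η := by
    intro s hs t ht
    obtain ⟨σ, -, h⟩ := hclose s hs
    obtain ⟨σ', -, h'⟩ := hclose t ht
    exact dist_le_abs_lineCoord_sub_add hab (g u) h h'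
  -- The coordinates of `g s₀` and `g t₁` differ by at least `R - 4η`. If `g t₁` were on the right,
  -- its coordinate would be at least `R - 5η > d`, but it is within `d` of `g u`, whose coordinate
  -- is `0`. The other end is symmetric, with `m` for `0`.
  have hleft : lineCoord (g u) a b (g t₁) ≤ lineCoord (g u) a b (g s₀) - (R - 4 * η) := by
    have e1 := hR₁.trans (hdist _ hs _ ht₁)
    have e2 := abs_le.1 ((abs_lineCoord_sub_le hab (g u) _ _).trans hd₁)
    rw [lineCoord_self] at e2
    rcases abs_cases (lineCoord (g u) a b (g s₀) - lineCoord (g u) a b (g t₁)) with h | h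
    · linarith
    · linarith [(hP _ hs).1]
  have hright : lineCoord (g u) a b (g s₀) + (R - 4 * η) ≤ lineCoord (g u) a b (g t₂) := by
    have e1 := hR₂.trans (hdist _ hs _ ht₂)
    have e2 := abs_le.1 ((abs_lineCoord_sub_le hab (g u) _ _).trans hd₂)
    rw [hPv] at e2
    rcases abs_cases (lineCoord (g u) a b (g s₀) - lineCoord (g u) a b (g t₂)) with h | h
    · linarith [(hP _ hs).2]
    · linarith
  refine ⟨range fun t : ℝ => g u * dil t ⟨m * a, m * b, 0⟩, lineCoord (g u) a b,
    ⟨_, _, rfl, hne, rfl⟩, lipschitzWith_lineCoord hab _, fun s hs => ?_, fun y hy => ?_⟩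
  · obtain ⟨σ, -, h⟩ := hclose s hs
    exact (Metric.infDist_le_dist_of_mem (mem_range_self σ)).trans h
  · obtain ⟨s, hs12, hsy⟩ := intermediate_value_Icc (hs₁.trans hs₂).le
      (((lipschitzWith_lineCoord hab (g u)).continuous.comp hg).continuousOn (s := Icc t₁ t₂))
      (⟨hleft.trans hy.1, hy.2.trans hright⟩ : y ∈ Icc _ _)
    have hsy : lineCoord (g u) a b (g s) = y := hsy
    have hsm : s ∈ Icc u v := ⟨h1.trans hs12.1, hs12.2.trans h2⟩
    refine ⟨g s, ⟨mem_image_of_mem g hsm, ?_⟩, hsy⟩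
    have := hdist s hsm s₀ hs
    -- Shortening the interval by `4η` on each side leaves room for the error in `hdist`, so the
    -- point stays in the ball of radius `R`.
    have h3 : |lineCoord (g u) a b (g s) - lineCoord (g u) a b (g s₀)| ≤ R - 4 * η := by
      rw [hsy, abs_le]
      constructor <;> linarith [hy.1, hy.2]
    rw [Metric.mem_closedBall]
    linarith

/-! ## The geometry of flat balls -/

theorem continuous_of_hasUnitSpeedOn {p : ℝ} {γ : AddCircle p → Heis}
    (hγ : HasUnitSpeedOn (fun t : ℝ => γ (t : AddCircle p)) univ) : Continuous γ := by
  have hL : LipschitzWith 1 (fun t : ℝ => γ (t : AddCircle p)) := by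
    intro x y
    wlog hxy : x ≤ y generalizing x y
    · rw [edist_comm, edist_comm x]
      exact this y x (le_of_not_ge hxy)
    have h := hγ (mem_univ x) (mem_univ y)
    have h2 := eVariationOn.edist_le (fun t : ℝ => γ (t : AddCircle p))
      (s := univ ∩ Icc x y) (⟨mem_univ x, le_rfl, hxy⟩ : x ∈ univ ∩ Icc x y)
      (⟨mem_univ y, hxy, le_rfl⟩ : y ∈ univ ∩ Icc x y)
    rw [h] at h2
    refine h2.trans (le_of_eq ?_)
    rw [edist_dist, Real.dist_eq, abs_sub_comm, abs_of_nonneg (sub_nonneg.2 hxy)]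
    simp
  exact (QuotientAddGroup.isQuotientMap_mk (N := AddSubgroup.zmultiples p)).continuous_iff.2
    hL.continuous

/-- A separated subset of a compact curve is countable. -/
theorem countable_of_separated {p : ℝ} {γ : AddCircle p → Heis} (hγ : Continuous γ) {S : Set Heis}
    (hS : S ⊆ range γ) {ε : ℝ} (hε : 0 < ε) (hsep : ∀ x ∈ S, ∀ y ∈ S, x ≠ y → ε ≤ dist x y) :
    S.Countable := by
  have hcoe : Continuous (fun s : ℝ => (s : AddCircle p)) := AddCircle.continuous_mk' p
  refine PairwiseDisjoint.countable_of_isOpen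
    (s := fun x => (fun s : ℝ => γ s) ⁻¹' Metric.ball x (ε / 2)) ?_
    (fun x _ => Metric.isOpen_ball.preimage (hγ.comp hcoe)) ?_
  · intro x hx y hy hxy
    refine Disjoint.preimage _ (Metric.ball_disjoint_ball ?_)
    linarith [hsep x hx y hy hxy]
  · intro x hx
    obtain ⟨t, rfl⟩ := hS hx
    obtain ⟨s, rfl⟩ := QuotientAddGroup.mk_surjective t
    exact ⟨s, Metric.mem_ball_self (by positivity)⟩

theorem countable_ballsG {p : ℝ} {γ : AddCircle p → Heis} (hγ : Continuous γ) {K : Set Heis}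
    (hK : K ⊆ range γ) {X : ℤ → Set Heis} (hX : IsNetFamily K X) : (ballsG X).Countable := by
  have h : ballsG X ⊆ ⋃ n : ℤ, (fun x => (⟨x, A * (2 : ℝ) ^ (-n)⟩ : HBall)) '' X n := by
    rintro B ⟨⟨n, hn, hr⟩, -⟩
    exact mem_iUnion.2 ⟨n, B.center, hn, HBall.ext rfl hr.symm⟩
  refine (countable_iUnion fun n => ?_).mono h
  exact (countable_of_separated hγ ((hX n).1.trans hK) (by positivity : (0 : ℝ) < 2 ^ (-n))
    (hX n).2.1).image _

theorem exists_dist_gt {Γ : Set Heis} (hdiam : Metric.diam Γ = 1) (x : Heis) :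
    ∃ w ∈ Γ, 2 / 5 < dist x w := by
  by_contra! h
  have : Metric.diam Γ ≤ 4 / 5 := by
    refine Metric.diam_le_of_forall_dist_le (by norm_num) fun y hy z hz => ?_
    have := dist_triangle_left y z x
    linarith [h y hy, h z hz]
  linarith

/-- The shift by `10` in `J_M` makes `2^{-J_M}` smaller than `2^{-M} · 10 ε₀ / 1024`. -/
theorem JM_spec (M : ℕ) : 10 < JM M ∧ (2 : ℝ) ^ (-JM M) ≤ (2 : ℝ) ^ (-(M : ℤ)) * eps0 / 100 := by
  have he : (0 : ℝ) < 10 * eps0 := by unfold eps0; positivity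
  have hlt : (M : ℝ) - Real.logb 2 (10 * eps0) + 10 < (JM M : ℝ) := by
    rw [JM]
    push_cast
    exact Int.lt_floor_add_one _
  have hlog : Real.logb 2 (10 * eps0) < 0 :=
    Real.logb_neg (by norm_num) he (by unfold eps0; norm_num)
  constructor
  · have : (10 : ℝ) < (JM M : ℝ) := by
      have : (0 : ℝ) ≤ M := Nat.cast_nonneg M
      linarith
    exact_mod_cast this
  · have h1 : (2 : ℝ) ^ (-JM M) ≤
        (2 : ℝ) ^ (-((M : ℝ) - Real.logb 2 (10 * eps0) + 10)) := by
      rw [← Real.rpow_intCast]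
      refine Real.rpow_le_rpow_of_exponent_le (by norm_num) ?_
      push_cast
      linarith
    have h2 : (2 : ℝ) ^ (-((M : ℝ) - Real.logb 2 (10 * eps0) + 10)) =
        (2 : ℝ) ^ (-(M : ℤ)) * (10 * eps0) * (1 / 1024) := by
      rw [show -((M : ℝ) - Real.logb 2 (10 * eps0) + 10) =
        ((-(M : ℤ) : ℤ) : ℝ) + Real.logb 2 (10 * eps0) + ((-10 : ℤ) : ℝ) by push_cast; ring,
        Real.rpow_add (by norm_num), Real.rpow_add (by norm_num), Real.rpow_intCast,
        Real.rpow_intCast, Real.rpow_logb (by norm_num) (by norm_num) he]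
      norm_num
    rw [h2] at h1
    have : 0 < (2 : ℝ) ^ (-(M : ℤ)) * eps0 := by unfold eps0; positivity
    linarith

/-- An arc of full length has image `Γ`, of diameter `1`. -/
theorem Arc.len_lt_of_diam_lt {p : ℝ} {γ : AddCircle p → Heis}
    {Γ : Set Heis} (hΓ : range γ = Γ) (hdiam : Metric.diam Γ = 1) (τ : Arc p)
    (h : τ.diam γ < 1) : τ.len < p := by
  refine τ.len_le.lt_of_ne fun heq => ?_
  have : Fact (0 < p) := ⟨heq ▸ τ.len_pos⟩
  have huniv : τ.carrier = univ := by
    obtain ⟨a, ha⟩ := QuotientAddGroup.mk_surjective τ.src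
    have ha : (a : AddCircle p) = τ.src := ha
    have : (fun s : ℝ => τ.src + (s : AddCircle p)) =
        (fun s : ℝ => (s : AddCircle p)) ∘ fun s => a + s := by
      funext s
      simp [← ha]
    rw [Arc.carrier, this, image_comp, image_const_add_Icc, heq, add_zero]
    exact AddCircle.coe_image_Icc_eq p a
  rw [Arc.diam, huniv, image_univ, hΓ, hdiam] at h
  exact lt_irrefl _ h

theorem ballsG_radius_pos {X : ℤ → Set Heis} {B : HBall} (h : B ∈ ballsG X) : 0 < B.radius := by
  obtain ⟨n, -, hr⟩ := h.1
  rw [hr, A]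
  positivity

/-- A flat ball is crossed by a part of `Γ` close to a horizontal line. -/
theorem exists_crossing_of_mem_ballsG2
    {p : ℝ} (hp : 0 < p) {γ : AddCircle p → Heis} (hγ : Continuous γ)
    {Γ : Set Heis} (hΓ : range γ = Γ) (hdiam : Metric.diam Γ = 1)
    {K : Set Heis} (hK : K ⊆ Γ) {X : ℤ → Set Heis} (hX : IsNetFamily K X)
    {D : ℕ} {Bi : Fin D → Set HBall}
    (hBi : IsDecomposition J0 kappa (HBall.double '' ballsG X) Bi)
    {l : Fin D → ℕ} {m : Fin D → ℤ}
    (hscale : ∀ i, ∀ B : HBall, B.double ∈ Bi i →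
      ∃ n ≥ m i, B.radius = scaleL (l i) * (2 : ℝ) ^ (-(n * J0)))
    {F : Fin D → ℤ → Set (Arc p)}
    (hF : ∀ i, IsFiltration γ J0 delta (scaleL (l i)) (m i)
      (prefiltration γ J0 (scaleL (l i)) (Bi i)) (F i))
    {B : HBall} (hB : B ∈ ballsG2 γ Γ X Bi l F) {s : ℝ} (hs0 : 0 < s) (hs1 : s ≤ 1)
    (hβ : betaBall Γ B ≤ s) :
    ∃ (L : Set Heis) (f : Heis → ℝ) (E : Set Heis), IsHorizontalLine L ∧ LipschitzWith 1 f ∧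
      E ⊆ Γ ∩ B.double.toSet ∧ (∀ y ∈ E, Metric.infDist y L ≤ eps0 * s * (16 * B.radius)) ∧
      Icc (f B.center - (2 * B.radius - 4 * (eps0 * s * (16 * B.radius))))
        (f B.center + (2 * B.radius - 4 * (eps0 * s * (16 * B.radius)))) ⊆ f '' E := by
  obtain ⟨hBG, hflat⟩ := hB
  have hr := ballsG_radius_pos hBG
  have hr100 := hBG.2
  have he : 0 < eps0 := by unfold eps0; positivity
  have heval : eps0 = 1 / 10000000000 := by unfold eps0; norm_num
  obtain ⟨k, hk, -⟩ := hBG.1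
  obtain ⟨t₀, ht₀⟩ : B.center ∈ range γ := hΓ ▸ hK ((hX k).1 hk)
  obtain ⟨i, hi⟩ : ∃ i, B.double ∈ Bi i := by
    have : B.double ∈ ⋃ i, Bi i := hBi.1 ▸ mem_image_of_mem _ hBG
    exact mem_iUnion.1 this
  have hS := hBi.scaleSeparated (by norm_num [J0]) (by
    rintro _ ⟨B', hB', rfl⟩
    have := ballsG_radius_pos hB'
    simp only [HBall.double]
    positivity) i
  have hdr : (B.double).radius = 2 * B.radius := rfl
  have hball : Metric.ball (γ t₀) (2 * B.radius) ⊆ cube (Bi i) B.double := by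
    rw [ht₀]
    exact Metric.ball_subset_closedBall.trans (subset_cube (Bi i) B.double)
  -- The cube has diameter at most `4r(1 + 3q)`, below `2/5` as `r < 1/100`, so `Γ` leaves it.
  have hout : ∃ t, γ t ∉ cube (Bi i) B.double := by
    obtain ⟨w, hw, hwd⟩ := exists_dist_gt hdiam B.center
    rw [← hΓ] at hw
    obtain ⟨t, rfl⟩ := hw
    refine ⟨t, fun hcon => ?_⟩
    have := hS.dist_le_of_mem_cube hi
      (subset_cube _ _ (HBall.center_mem (B := B.double) (by rw [hdr]; positivity))) hcon
    rw [hdr] at this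
    have h2 : dist B.center (γ t) ≤ _ := this
    nlinarith [hS.q_le]
  obtain ⟨τ, t₁, s₀, t₂, h1, h2, hst, hcar, hcl, hR₁, hR₂⟩ :=
    exists_component_arc hp hγ (by positivity : 0 < 2 * B.radius) t₀ hball hout
  have hs₀ : (s₀ : AddCircle p) ∈ τ.carrier := hcar ▸ mem_image_of_mem _ ⟨h1.le, h2.le⟩
  have hτ : τ ∈ arcsThrough γ (cube (Bi i) B.double) B.toSet := by
    refine ⟨⟨t₀, hball (Metric.mem_ball_self (by positivity)), hcl⟩, B.center, ?_,
      HBall.center_mem hr.le⟩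
    exact ⟨_, hs₀, by rw [hst, ht₀]⟩
  obtain ⟨n, hnm, hrn⟩ := hscale i B hi
  obtain ⟨τ', hτ'F, hsub, -, hcomp⟩ := (hF i).extends_arcs n hnm τ ⟨B, hi, hrn, hτ⟩
  have hβτ := hflat i hi τ' ⟨n, hrn, hτ'F, τ, hτ, hsub⟩
  have hdτ := ((hF i).diam_bounds n hnm τ' hτ'F).2
  rw [zpow_add₀ two_ne_zero, ← mul_assoc, ← hrn] at hdτ
  have hdτ : τ'.diam γ < 16 * B.radius := by
    rw [mul_comm]
    convert hdτ using 2
    norm_num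
  have hβτ : τ'.beta γ < eps0 * s := hβτ.trans_le (mul_le_mul_of_nonneg_left hβ he.le)
  have hlen := τ'.len_lt_of_diam_lt hΓ hdiam (hdτ.trans (by linarith))
  obtain ⟨u, v, hu, hv, huv, hsrc, htgt, hcar'⟩ :=
    τ'.exists_lift hlen (h1.trans h2).le (hcar ▸ hsub)
  have hδ : 0 < delta := by unfold delta; positivity
  have hends := dist_endpoints_le hp hγ (d := delta * B.radius) (by positivity) hu (h1.trans h2).le
    hv huv (by
      rw [hrn, ← mul_assoc, ← hcar, ← hcar']
      exact hcomp)
  have hclose : ∀ w ∈ Icc u v, ∃ σ ∈ Icc (0 : ℝ) 1,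
      dist (γ (w : AddCircle p)) (γ (u : AddCircle p) *
        dil σ (proj ((γ (u : AddCircle p))⁻¹ * γ (v : AddCircle p)))) ≤
          eps0 * s * (16 * B.radius) := by
    intro w hw
    rw [hsrc, htgt]
    exact τ'.exists_close_point hp hγ (by positivity) (by positivity) hβτ hdτ.le
      (hcar' ▸ mem_image_of_mem _ hw)
  have hx : γ (s₀ : AddCircle p) = B.center := by rw [hst, ht₀]
  have hsmall : 5 * (eps0 * s * (16 * B.radius)) + delta * B.radius < 2 * B.radius := by
    have hdel : delta ≤ 1 / 2 := by unfold delta; norm_num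
    have : s * B.radius ≤ 1 * B.radius := by gcongr
    rw [heval]
    nlinarith
  rw [← hst] at hR₁ hR₂
  obtain ⟨L, f, hL, hf, hEL, hfE⟩ := exists_flat_crossing
    (g := fun w : ℝ => γ (w : AddCircle p)) (hγ.comp (AddCircle.continuous_mk' p)) hu h1 h2 hv
    hR₁ hR₂ hends.1 hends.2 hclose hsmall
  simp only [hx] at hfE
  refine ⟨L, f, _, hL, hf, ?_, ?_, hfE⟩
  · rintro _ ⟨⟨w, hw, rfl⟩, hy⟩
    exact ⟨hΓ ▸ mem_range_self _, hy⟩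
  · rintro _ ⟨⟨w, hw, rfl⟩, hy⟩
    exact hEL w hw

/-- A connected set contains points at all small distances from each of its points. -/
theorem Icc_subset_dist_image {p : ℝ} {γ : AddCircle p → Heis} (hγ : Continuous γ) {Γ : Set Heis}
    (hΓ : range γ = Γ) (hdiam : Metric.diam Γ = 1) {z : Heis} (hz : z ∈ Γ) {ρ : ℝ}
    (hρ : ρ ≤ 2 / 5) : Icc 0 ρ ⊆ (fun y => dist y z) '' (Γ ∩ Metric.closedBall z ρ) := by
  intro a ha
  obtain ⟨w, hw, hwd⟩ := exists_dist_gt hdiam z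
  rw [← hΓ] at hz hw
  obtain ⟨t, rfl⟩ := hz
  obtain ⟨t', rfl⟩ := hw
  have : PreconnectedSpace (AddCircle p) := inferInstance
  obtain ⟨c, hc⟩ := mem_range_of_exists_le_of_exists_ge
    (f := fun c => dist (γ c) (γ t)) (hγ.dist continuous_const)
    ⟨t, by simpa using ha.1⟩ ⟨t', by rw [dist_comm]; linarith [ha.2]⟩
  exact ⟨γ c, ⟨hΓ ▸ mem_range_self c, (le_of_eq hc).trans ha.2⟩, hc⟩

/-- The crossing `E` nearly recovers the diameter of the cube, and the piece of `Γ` within `s r / 8`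
of `z` adds a length `s r / 8` that outweighs the losses of order `ε₀ s r`. -/
theorem cube_length_growth
    {p : ℝ} (hp : 0 < p) {γ : AddCircle p → Heis} (hγ : Continuous γ)
    {Γ : Set Heis} (hΓ : range γ = Γ) (hdiam : Metric.diam Γ = 1)
    {Bs : Set HBall} (hcount : Bs.Countable) {q s : ℝ} (hS : ScaleSeparated q Bs) (hs0 : 0 < s)
    (hs1 : s ≤ 1) (hq : q ≤ s * eps0 / 100) {B : HBall} (hB : B.double ∈ Bs) (hr : 0 < B.radius)
    (hr100 : B.radius < 1 / 100) {L E : Set Heis} {f : Heis → ℝ} (hf : LipschitzWith 1 f)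
    (hE : E ⊆ Γ ∩ B.double.toSet)
    (hEL : ∀ y ∈ E, Metric.infDist y L ≤ eps0 * s * (16 * B.radius))
    (hfE : Icc (f B.center - (2 * B.radius - 4 * (eps0 * s * (16 * B.radius))))
        (f B.center + (2 * B.radius - 4 * (eps0 * s * (16 * B.radius)))) ⊆ f '' E)
    {z : Heis} (hz : z ∈ Γ ∩ B.toSet) (hzL : s / 2 * B.radius ≤ Metric.infDist z L)
    (T : Finset HBall) (hT : ∀ B' ∈ T, B' ∈ Bs ∧ B'.radius < B.double.radius) :
    (1 + ENNReal.ofReal (eps0 / 10 * s)) * Metric.ediam (cube Bs B.double) ≤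
      (Measure.hausdorffMeasure 1).restrict Γ (cube Bs B.double \ ⋃ B' ∈ T, cube Bs B') +
        ∑ B' ∈ T, Metric.ediam (cube Bs B') := by
  have heval : eps0 = 1 / 10000000000 := by unfold eps0; norm_num
  have he : 0 < eps0 := by rw [heval]; norm_num
  have : Fact (0 < p) := ⟨hp⟩
  have hΓc : IsCompact Γ := hΓ ▸ isCompact_range hγ
  have hsr : 0 < s * B.radius := by positivity
  have hsr1 : s * B.radius ≤ 1 * B.radius := by gcongr
  have hdr : (B.double).radius = 2 * B.radius := rfl
  have hq0 := hS.q_pos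
  have hq1 := hS.q_le
  have hqr : q * B.radius ≤ s * B.radius * eps0 / 100 := by
    have := mul_le_mul_of_nonneg_right hq hr.le
    linarith
  -- From `s r / 2` one subtracts `s r / 8` for the ball around `z` and `16 ε₀ s r` for the distance
  -- of `E` to `L`.
  have hfar : ∀ y ∈ E, ∀ y' ∈ Γ ∩ Metric.closedBall z (s / 8 * B.radius),
      s / 4 * B.radius < dist y y' := by
    intro y hy y' hy'
    have h1 : dist y' z ≤ s / 8 * B.radius := hy'.2
    have h2 := Metric.infDist_le_infDist_add_dist (s := L) (x := z) (y := y)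
    have h3 := dist_triangle_right z y y'
    rw [dist_comm z y'] at h3
    have h4 := hEL y hy
    rw [heval] at h4
    linarith
  have hdouble : B.double.toSet ⊆ cube Bs B.double := subset_cube _ _
  refine le_trans ?_ (ofReal_add_ofReal_le (ι := HBall) hf (LipschitzWith.dist_left z)
    (E' := Γ ∩ Metric.closedBall z (s / 8 * B.radius)) hfE
    (Icc_subset_dist_image hγ hΓ hdiam hz.1 (by linarith))
    (fun y hy => ⟨(hE hy).1, hdouble (hE hy).2⟩) ?_ ?_
    (hΓc.isClosed.measurableSet.inter Metric.isClosed_closedBall.measurableSet)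
    hΓc.isClosed.measurableSet (fun B' => measurableSet_cube hcount B') T ?_)
  · refine (mul_le_mul_right (hS.ediam_cube_le hB) _).trans ?_
    rw [hdr, ← ENNReal.ofReal_one, ← ENNReal.ofReal_add (by norm_num) (by positivity),
      ← ENNReal.ofReal_mul (by positivity), ← ENNReal.ofReal_add]
    · refine ENNReal.ofReal_le_ofReal ?_
      have h1 : (1 + eps0 / 10 * s) * (2 * (2 * B.radius) * (1 + 3 * q)) =
          4 * B.radius + 4 * (eps0 / 10) * (s * B.radius) + 12 * (q * B.radius) +
            12 * (eps0 / 10 * s) * (q * B.radius) := by ring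
      have h2 : eps0 / 10 * s * (q * B.radius) ≤ 1 * (q * B.radius) := by
        refine mul_le_mul_of_nonneg_right ?_ (by positivity)
        rw [heval]
        linarith
      rw [h1]
      rw [heval] at *
      linarith
    · rw [heval]
      linarith
    · linarith
  · intro y hy
    refine ⟨hy.1, hdouble ?_⟩
    have h1 : dist y z ≤ s / 8 * B.radius := hy.2
    have h2 : dist z B.center ≤ B.radius := hz.2
    have h3 := dist_triangle y z B.center
    have h4 : dist y B.center ≤ 2 * B.radius := by linarith
    exact h4
  · rw [disjoint_left]
    intro y hy hy'
    have := hfar y hy y hy'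
    rw [dist_self] at this
    linarith
  -- A cube of a smaller ball has diameter at most `4 r(B') ≤ 8 q r`, far below the gap `s r / 4`
  -- between the two pieces.
  · rintro B' hB' ⟨⟨y, hyQ, hy⟩, ⟨y', hyQ', hy'⟩⟩
    have h1 := hfar y hy y' hy'
    have h2 := hS.dist_le_of_mem_cube (hT B' hB').1 hyQ hyQ'
    have h3 := hS.ratio B' (hT B' hB').1 _ hB (hT B' hB').2
    rw [hdr] at h3
    have h4 : 2 * B'.radius * (1 + 3 * q) ≤ 4 * B'.radius := by
      have := hS.pos B' (hT B' hB').1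
      nlinarith
    rw [heval] at hqr
    linarith

end HeisTSP

/-! ### The packing estimate for flat balls -/

theorem propositionp
    (p : ℝ) (hp : 0 < p) (γ : AddCircle p → Heis)
    (hγ : HasUnitSpeedOn (fun t : ℝ => γ (t : AddCircle p)) univ)
    (Γ : Set Heis) (hΓ : range γ = Γ) (hdiam : Metric.diam Γ = 1)
    (K : Set Heis) (hK : K ⊆ Γ) (X : ℤ → Set Heis) (hX : IsNetFamily K X)
    (D : ℕ) (Bi : Fin D → Set HBall)
    (hBi : IsDecomposition J0 kappa (HBall.double '' ballsG X) Bi)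
    (l : Fin D → ℕ) (hl : ∀ i, (l i : ℤ) < J0) (m : Fin D → ℤ)
    (hscale : ∀ i, ∀ B : HBall, B.double ∈ Bi i →
      ∃ n ≥ m i, B.radius = scaleL (l i) * (2 : ℝ) ^ (-(n * J0)))
    (F : Fin D → ℤ → Set (Arc p))
    (hF : ∀ i, IsFiltration γ J0 delta (scaleL (l i)) (m i)
      (prefiltration γ J0 (scaleL (l i)) (Bi i)) (F i))
    (M : ℕ) (D' : ℕ) (BM : Fin D' → Set HBall)
    (hBM : IsDecomposition (JM M) kappa (ballsM Γ (ballsG2 γ Γ X Bi l F) M) BM)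
    (i : Fin D') :
    ∑' Q : ↥(cubes (BM i)), Metric.ediam (Q : Set Heis) ≤
      ENNReal.ofReal (10 / eps0 * 2 ^ M) * Measure.hausdorffMeasure 1 Γ := by
  have hcont := continuous_of_hasUnitSpeedOn hγ
  have he : 0 < eps0 := by unfold eps0; positivity
  have hs0 : (0 : ℝ) < 2 ^ (-(M : ℤ)) := by positivity
  have hs1 : (2 : ℝ) ^ (-(M : ℤ)) ≤ 1 := zpow_le_one_of_nonpos₀ (by norm_num) (by omega)
  have hsub : BM i ⊆ ballsM Γ (ballsG2 γ Γ X Bi l F) M := hBM.1 ▸ subset_iUnion BM i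
  have hcount : (BM i).Countable := by
    refine ((countable_ballsG hcont (hΓ ▸ hK) hX).image HBall.double).mono (hsub.trans ?_)
    exact image_mono fun B hB => hB.1.1
  have hS := hBM.scaleSeparated (by linarith [(JM_spec M).1]) (by
    rintro _ ⟨B, hB, rfl⟩
    have := ballsG_radius_pos hB.1.1
    simp only [HBall.double]
    positivity) i
  have hsum := tsum_cubes_le hS hcount (μ := (Measure.hausdorffMeasure 1).restrict Γ)
    (c := ENNReal.ofReal (eps0 / 10 * 2 ^ (-(M : ℤ)))) (by
      intro C hC T hT
      obtain ⟨B, ⟨hB, hβ⟩, rfl⟩ := hsub hC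
      have hr := ballsG_radius_pos hB.1
      obtain ⟨L, f, E, hL, hf, hE, hEL, hfE⟩ := exists_crossing_of_mem_ballsG2 hp hcont hΓ hdiam
        hK hX hBi hscale hF hB hs0 hs1 hβ.2
      have hβ1 : (2 : ℝ) ^ (-(M : ℤ)) / 2 ≤ betaBall Γ B := by
        have := hβ.1
        rwa [zpow_sub₀ two_ne_zero, zpow_one] at this
      obtain ⟨z, hz, hzL⟩ := exists_far_point hr (by positivity) hβ1 hL
      exact cube_length_growth hp hcont hΓ hdiam hcount hS hs0 hs1 (JM_spec M).2 hC hr hB.1.2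
        hf hE hEL hfE hz hzL T hT)
  rw [Measure.restrict_apply_univ] at hsum
  -- The constant of the theorem is the inverse of the surplus factor `ε₀ 2^{-M} / 10`.
  have hmul : ENNReal.ofReal (10 / eps0 * 2 ^ M) *
      ENNReal.ofReal (eps0 / 10 * 2 ^ (-(M : ℤ))) = 1 := by
    rw [← ENNReal.ofReal_mul (by positivity), ← ENNReal.ofReal_one]
    congr 1
    rw [zpow_neg, zpow_natCast]
    field_simp
  calc _ = ENNReal.ofReal (10 / eps0 * 2 ^ M) * (ENNReal.ofReal (eps0 / 10 * 2 ^ (-(M : ℤ))) *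
        ∑' Q : ↥(cubes (BM i)), Metric.ediam (Q : Set Heis)) := by
        rw [← mul_assoc, hmul, one_mul]
    _ ≤ _ := mul_le_mul_right hsum _
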